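/- There is a deterministic leader election algorithm for the $\mathrm{KT}_1$ LOCAL model and an absolute constant $C$ such that the following holds. Let $G$ be a connected undirected graph with $n\ge 1$ nodes and diameter $D$, and let the nodes have arbitrary distinct identifiers (natural numbers). Initially each node knows only its own identifier and the set of identifiers of its neighbors (in particular, neither $n$ nor $D$ is known). All nodes run the algorithm in synchronous rounds, starting simultaneously; in each round a node may send to each of its neighbors one message of unrestricted size, and local computation is arbitrary. Then after at most $$C\,(D\log^2 n+\log^2 n)$$ rounds all nodes have terminated, and all of them output the identifier of one and the same node of $G$, the leader (so exactly one node is elected, and every node knows whether it is the leader). In total, over the whole execution, all nodes together send at most $$C\, n\log^2 n$$ messages. -/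

import Mathlib

/-- A deterministic distributed algorithm for the synchronous KT1 LOCAL model, in which every node
produces an output of type `Out`.  The same algorithm runs at every node of every network.

* `init i N` is the initial state of a node whose identifier is `i` and whose neighbors have exactly
  the identifiers in `N`; this is all that a node knows at the start.  In particular nothing is
  known about the size or the diameter of the network.
* `send s j` is the message (if any) that a node in state `s` sends in the current round to its
  neighbor with identifier `j`.
* `receive s inbox` is the next state of a node in state `s`, where `inbox j` is the message (if any)
  that it receives in the current round from its neighbor with identifier `j`.
* `output s = some o` says that `s` is a terminated state with output `o`; `output s = none` says
  that a node in state `s` is still running.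

Messages are elements of an arbitrary type: their size is not restricted.  Local computation is
arbitrary. -/
structure KT1LocalAlgorithm (Out : Type) where
  State : Type
  Msg : Type
  init : ℕ → Finset ℕ → State
  send : State → ℕ → Option Msg
  receive : State → (ℕ → Option Msg) → State
  output : State → Option Out

namespace KT1LocalAlgorithm

variable {Out : Type} (A : KT1LocalAlgorithm Out) {V : Type*} (G : SimpleGraph V) (ids : V ↪ ℕ)

open Classical in
/-- The message (if any) that travels from `w` to `v` in a round that starts in the global
configuration `s`.  Messages travel only along edges, and terminated nodes send nothing. -/
noncomputable def sent (s : V → A.State) (w v : V) : Option A.Msg :=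
  if G.Adj w v ∧ A.output (s w) = none then A.send (s w) (ids v) else none

/-- The messages that `v` receives in a round, indexed by the identifier of the sender. -/
noncomputable def inbox (s : V → A.State) (v : V) : ℕ → Option A.Msg :=
  Function.extend ids (fun w => A.sent G ids s w v) (fun _ => none)

/-- One synchronous round, performed simultaneously by all nodes.  Terminated nodes do not change
their state any more. -/
noncomputable def step (s : V → A.State) : V → A.State := fun v =>
  if A.output (s v) = none then A.receive (s v) (A.inbox G ids s v) else s v

variable [Fintype V]

open Classical in
/-- The initial global configuration. -/
noncomputable def start : V → A.State := fun v =>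
  A.init (ids v) ((Finset.univ.filter fun w => G.Adj v w).map ids)

/-- The global configuration after `t` rounds. -/
noncomputable def run (t : ℕ) : V → A.State :=
  (A.step G ids)^[t] (A.start G ids)

open Classical in
/-- The number of messages that all nodes together send in a round that starts in the global
configuration `s`. -/
noncomputable def messagesInRound (s : V → A.State) : ℕ :=
  (Finset.univ.filter fun p : V × V => A.sent G ids s p.1 p.2 ≠ none).card

/-- The total number of messages that all nodes send in the first `t` rounds. -/
noncomputable def messageCount (t : ℕ) : ℕ :=
  ∑ r ∈ Finset.range t, A.messagesInRound G ids (A.run G ids r)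

end KT1LocalAlgorithm

/-- After `t` rounds all nodes have terminated and have elected a unique leader `l`: every node
outputs the identifier of `l`.  Since identifiers are distinct, `l` is the only node that outputs its
own identifier (the elected node), and every other node knows that it is not elected. -/
def ElectsLeaderBy (A : KT1LocalAlgorithm ℕ) {V : Type*} [Fintype V] (G : SimpleGraph V)
    (ids : V ↪ ℕ) (t : ℕ) : Prop :=
  ∃ l : V, ∀ v : V, A.output (A.run G ids t v) = some (ids l)

/-! The election runs on a sparse spanner of the network, so that messages are charged to `O(n log
n)` edges instead of to all edges.

The spanner comes from deterministic rumor spreading. In iteration `i` every node with unknown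
neighbors links to one of them, and rumors travel out along the links of iterations `i, …, 0` and
back along those of `0, …, i`. On the way out the rumor of `v` reaches a binomial tree, `btree N (i
+ 1) v`, and `x` learns it exactly if the trees of `v` and `x` meet (`mem_rumors_last`). Neighbors
that are still unknown therefore have disjoint trees, the trees of active nodes double in size
(`card_btree`), and after `log₂ n` iterations no neighbor is unknown (`unk_eq_empty`). Trees that
meet yield detours of length at most `2 log₂ n` (`spanner_stretch`). There are at most `n log₂ n`
links, and every round costs at most `n` messages.

The election proceeds in phases. In each, trees ("kingdoms") grow from the surviving roots. A root
collects the roots of the adjacent kingdoms (`E`), hands this set down (`F`), and collects the sets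
handed down in the adjacent kingdoms (`D`); it survives if it is the largest root it has seen. A
survivor `c` is adjacent to the kingdom of a smaller root `d`, which loses, and `c` is the largest
root adjacent to `d`. So `d` determines `c`, and at most half of the roots survive (`exists_loser`,
`card_roots_succ`). Hence there are at most `log₂ n + 1` phases, and the last root recognizes itself
by `E p = {v}`.

Phases are not synchronized: an entry of a record is written once, when the entries it depends on
are present, so correctness is a set of monotone invariants (`electionInv`). Writing once also means
that a record changes `O(log n)` times, which over the spanner edges gives `O(n log² n)` messages. A
phase lasts `O(K)` rounds for `K = 2 D log₂ n`, apart from the initial wait for the spanner. The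
winner is flooded over the spanner, and each node terminates one round after hearing of it. A winner
exists only once all nodes have completed their spanner edges, so termination disturbs nothing
(`runInv_succ`). -/

/-! ### Walks along neighbor lists -/

/-- `within N k x y`: there is a walk of length at most `k` from `x` to `y` along the neighbor
lists `N`. -/
def within (N : ℕ → Finset ℕ) : ℕ → ℕ → ℕ → Prop
  | 0, x, y => x = y
  | k + 1, x, y => ∃ z, within N k x z ∧ (y = z ∨ y ∈ N z)

section within
variable {N : ℕ → Finset ℕ}

theorem within.succ {k x y : ℕ} (h : within N k x y) : within N (k + 1) x y := ⟨y, h, Or.inl rfl⟩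

theorem within.mono {k l x y : ℕ} (h : within N k x y) (hkl : k ≤ l) : within N l x y := by
  induction hkl with
  | refl => exact h
  | step _ ih => exact ih.succ

theorem within.refl (N : ℕ → Finset ℕ) (k x : ℕ) : within N k x x :=
  within.mono (k := 0) rfl (Nat.zero_le k)

theorem within.trans {k l x y z : ℕ} (h : within N k x y) (h' : within N l y z) :
    within N (k + l) x z := by
  induction l generalizing z with
  | zero => cases h'; exact h
  | succ l ih =>
    obtain ⟨w, hw, hz⟩ := h'
    exact ⟨w, ih hw, hz⟩

theorem within.single {x y : ℕ} (h : y ∈ N x) : within N 1 x y := ⟨x, rfl, Or.inr h⟩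

theorem within.symm (hN : ∀ x y, y ∈ N x → x ∈ N y) {k x y : ℕ} (h : within N k x y) :
    within N k y x := by
  induction k generalizing y with
  | zero => exact Eq.symm h
  | succ k ih =>
    obtain ⟨z, hz, rfl | hy⟩ := h
    · exact (ih hz).succ
    · have := (within.single (hN _ _ hy)).trans (ih hz)
      rwa [add_comm] at this

/-- A spanner of stretch `s` multiplies distances by at most `s`. -/
theorem within.stretch {L : ℕ → Finset ℕ} {s : ℕ} (h : ∀ x y, y ∈ N x → within L s x y)
    {k x y : ℕ} (hk : within N k x y) : within L (s * k) x y := by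
  induction k generalizing y with
  | zero => exact hk
  | succ k ih =>
    obtain ⟨z, hz, rfl | hy⟩ := hk
    · exact (ih hz).mono (by gcongr; omega)
    · exact (ih hz).trans (h _ _ hy)

end within

/-! ### Transfer of executions to networks of identifiers -/

namespace KT1LocalAlgorithm

variable {Out : Type} (A : KT1LocalAlgorithm Out)

open Classical in
/-- One round of `A` on a network whose nodes are their own identifiers and whose neighbor lists are
given by `N`. -/
noncomputable def netStep (N : ℕ → Finset ℕ) (s : ℕ → A.State) : ℕ → A.State := fun x =>
  if A.output (s x) = none then
    A.receive (s x) fun y => if y ∈ N x ∧ A.output (s y) = none then A.send (s y) x else none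
  else s x

/-- The configuration after `t` rounds on the network with neighbor lists `N`. -/
noncomputable def netRun (N : ℕ → Finset ℕ) : ℕ → ℕ → A.State
  | 0 => fun x => A.init x (N x)
  | t + 1 => A.netStep N (netRun N t)

variable {V : Type*} [Fintype V] (G : SimpleGraph V) (ids : V ↪ ℕ)

open Classical in
/-- The identifiers of the neighbors of the node with identifier `x`. -/
noncomputable def nbrIds (x : ℕ) : Finset ℕ :=
  (Finset.univ.filter fun w => ∃ v, ids v = x ∧ G.Adj v w).map ids

theorem mem_nbrIds {v w : V} : ids w ∈ nbrIds G ids (ids v) ↔ G.Adj v w := by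
  classical
  simp [nbrIds]

theorem exists_of_mem_nbrIds {x y : ℕ} (h : y ∈ nbrIds G ids x) :
    ∃ v w, ids v = x ∧ ids w = y ∧ G.Adj v w := by
  classical
  simp only [nbrIds, Finset.mem_map, Finset.mem_filter, Finset.mem_univ, true_and] at h
  obtain ⟨w, ⟨v, hv, hvw⟩, hw⟩ := h
  exact ⟨v, w, hv, hw, hvw⟩

open Classical in
theorem inbox_eq (s : ℕ → A.State) (v : V) :
    A.inbox G ids (fun w => s (ids w)) v = fun y =>
      if y ∈ nbrIds G ids (ids v) ∧ A.output (s y) = none then A.send (s y) (ids v) else none := by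
  funext y
  by_cases hy : ∃ w, ids w = y
  · obtain ⟨w, rfl⟩ := hy
    rw [inbox, ids.injective.extend_apply, sent]
    exact if_congr (and_congr_left' ((G.adj_comm w v).trans (mem_nbrIds G ids).symm)) rfl rfl
  · rw [inbox, Function.extend_apply' _ _ _ hy, if_neg]
    rintro ⟨h, -⟩
    obtain ⟨_, w, _, hw, _⟩ := exists_of_mem_nbrIds G ids h
    exact hy ⟨w, hw⟩

theorem run_eq_netRun (t : ℕ) :
    A.run G ids t = fun v => A.netRun (nbrIds G ids) t (ids v) := by
  classical
  induction t with
  | zero =>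
    funext v
    simp only [run, Function.iterate_zero, id, start, netRun, nbrIds]
    congr 2
    ext w
    simp
  | succ t ih =>
    rw [run, Function.iterate_succ_apply', ← run, ih]
    funext v
    rw [step, inbox_eq]
    rfl

open Classical in
/-- Messages of a round, as pairs of identifiers. -/
theorem messagesInRound_le (t : ℕ) :
    A.messagesInRound G ids (A.run G ids t) ≤
      (((Finset.univ.map ids) ×ˢ (Finset.univ.map ids)).filter fun p : ℕ × ℕ =>
        A.output (A.netRun (nbrIds G ids) t p.1) = none ∧
          A.send (A.netRun (nbrIds G ids) t p.1) p.2 ≠ none).card := by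
  rw [run_eq_netRun, messagesInRound]
  apply Finset.card_le_card_of_injOn (fun p => (ids p.1, ids p.2))
  · rintro ⟨v, w⟩ h
    simp only [Finset.coe_filter, Finset.mem_univ, true_and, Set.mem_ofPred_eq, sent] at h
    split_ifs at h with h'
    · simp [h'.2, h]
    · exact absurd rfl h
  · rintro ⟨v, w⟩ - ⟨v', w'⟩ - h
    simpa using h

theorem within_of_connected (hG : G.Connected) (v w : V) :
    within (nbrIds G ids) G.diam (ids v) (ids w) := by
  have key : ∀ {a b : V} (p : G.Walk a b), within (nbrIds G ids) p.length (ids a) (ids b) := by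
    intro a b p
    induction p with
    | nil => exact within.refl _ _ _
    | cons h p ih =>
      have := (within.single ((mem_nbrIds G ids).2 h)).trans ih
      rwa [add_comm] at this
  obtain ⟨p, hp⟩ := hG.exists_walk_length_eq_dist v w
  have : Nonempty V := ⟨v⟩
  exact (key p).mono (hp ▸ SimpleGraph.dist_le_diam (SimpleGraph.connected_iff_ediam_ne_top.1 hG))

end KT1LocalAlgorithm

/-! ### The spanner construction: local rules and schedule -/

/-- A choice function for finite sets of identifiers. -/
def pick (s : Finset ℕ) : Option ℕ := if h : s.Nonempty then some (s.min' h) else none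

theorem mem_of_pick {s : Finset ℕ} {x : ℕ} (h : pick s = some x) : x ∈ s := by
  unfold pick at h
  split_ifs at h with hs
  cases h
  exact s.min'_mem hs

theorem exists_pick {s : Finset ℕ} (h : s.Nonempty) : ∃ x, pick s = some x :=
  ⟨_, dif_pos h⟩

theorem pick_empty : pick ∅ = none := rfl

/-- The state of a node during the construction of the spanner.  In iteration `i` the node still
has the unknown neighbors `unk`; `out j` is the link that it chose in iteration `j`, and `inn j` are
the neighbors that chose it in iteration `j`.  An iteration has `2 * i + 2` rounds, the current one
being `k`, in which the rumors `X` travel first along the links of the iterations `i, …, 0` and then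
backwards along the links of the iterations `0, …, i`. -/
structure SpState where
  me : ℕ
  i : ℕ
  k : ℕ
  nbr : Finset ℕ
  unk : Finset ℕ
  out : ℕ → Option ℕ
  inn : ℕ → Finset ℕ
  X : Finset ℕ

namespace SpState

def init (x : ℕ) (N : Finset ℕ) : SpState where
  me := x
  i := 0
  k := 0
  nbr := N
  unk := N
  out := fun j => if j = 0 then pick N else none
  inn := fun _ => ∅
  X := if N = ∅ then ∅ else {x}

def send (s : SpState) (y : ℕ) : Option (Finset ℕ) :=
  if s.X = ∅ then none
  else if s.k ≤ s.i then (if s.out (s.i - s.k) = some y then some s.X else none)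
  else if y ∈ s.inn (s.k - s.i - 1) then some s.X else none

/-- The rumors known after receiving the messages of a round. -/
def merge (s : SpState) (inbox : ℕ → Option (Finset ℕ)) : Finset ℕ :=
  s.X ∪ s.nbr.biUnion fun y => (inbox y).getD ∅

def newInn (s : SpState) (inbox : ℕ → Option (Finset ℕ)) (j : ℕ) : Finset ℕ :=
  if s.k = 0 ∧ j = s.i then s.nbr.filter fun y => inbox y ≠ none else s.inn j

def recv (s : SpState) (inbox : ℕ → Option (Finset ℕ)) : SpState :=
  if s.k = 2 * s.i + 1 then
    { s with
      i := s.i + 1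
      k := 0
      unk := s.unk \ s.merge inbox
      out := fun j => if j = s.i + 1 then pick (s.unk \ s.merge inbox) else s.out j
      inn := s.newInn inbox
      X := if s.unk \ s.merge inbox = ∅ then ∅ else {s.me} }
  else { s with k := s.k + 1, inn := s.newInn inbox, X := s.merge inbox }

open Classical in
/-- The spanner edges at a node that are known so far. -/
noncomputable def links (s : SpState) : Finset ℕ :=
  s.nbr.filter fun y => ∃ j, s.out j = some y ∨ y ∈ s.inn j

end SpState

/-- The messages for `x` of the spanner construction in configuration `s`. -/
def spInbox (N : ℕ → Finset ℕ) (s : ℕ → SpState) (x y : ℕ) : Option (Finset ℕ) :=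
  if y ∈ N x then (s y).send x else none

/-- The configuration of the spanner construction after `t` rounds. -/
def sp (N : ℕ → Finset ℕ) : ℕ → ℕ → SpState
  | 0, x => SpState.init x (N x)
  | t + 1, x => (sp N t x).recv (spInbox N (sp N t) x)

/-- The first round of iteration `i`. -/
def iterStart (i : ℕ) : ℕ := i * (i + 1)

theorem iterStart_succ (i : ℕ) : iterStart (i + 1) = iterStart i + (2 * i + 1) + 1 := by
  unfold iterStart; ring

theorem exists_iterStart (t : ℕ) : ∃ i k, k ≤ 2 * i + 1 ∧ t = iterStart i + k := by
  induction t with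
  | zero => exact ⟨0, 0, by omega, rfl⟩
  | succ t ih =>
    obtain ⟨i, k, hk, rfl⟩ := ih
    rcases hk.lt_or_eq with h | rfl
    · exact ⟨i, k + 1, by omega, rfl⟩
    · exact ⟨i + 1, 0, by omega, by rw [iterStart_succ]⟩

theorem iterStart_le {i j k t : ℕ} (hk : k ≤ 2 * i + 1) (ht : t = iterStart i + k)
    (h : iterStart j ≤ t) : j ≤ i := by
  by_contra! hij
  have h1 : iterStart (i + 1) ≤ iterStart j := by unfold iterStart; gcongr <;> exact hij
  rw [iterStart_succ] at h1
  omega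

/-- A symmetric, irreflexive system of neighbor lists on the finite set `U`. -/
structure IsNet (N : ℕ → Finset ℕ) (U : Finset ℕ) : Prop where
  sub : ∀ x, N x ⊆ U
  symm : ∀ x y, y ∈ N x → x ∈ N y
  irrefl : ∀ x, x ∉ N x

/-! ### Rumors spread along binomial trees -/

section spanner
variable (N : ℕ → Finset ℕ)

/-- The neighbors that are unknown to `x` at the start of iteration `i`. -/
def unk (i x : ℕ) : Finset ℕ := (sp N (iterStart i) x).unk

/-- The link that `x` chooses in iteration `i`. -/
def link (i x : ℕ) : Option ℕ := pick (unk N i x)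

/-- The rumors known to `x` after round `t`. -/
def rumors (t x : ℕ) : Finset ℕ := (sp N t x).merge (spInbox N (sp N t) x)

/-- The binomial tree of order `j` that hangs on `x`. -/
def btree : ℕ → ℕ → Finset ℕ
  | 0, x => {x}
  | j + 1, x => btree j x ∪ ((link N j x).elim ∅ (btree j))

/-- The form of the configuration in round `k` of iteration `i`. -/
structure SpInv (i k : ℕ) (x : ℕ) (s : SpState) : Prop where
  me : s.me = x
  hi : s.i = i
  hk : s.k = k
  nbr : s.nbr = N x
  unk : s.unk = unk N i x
  out : ∀ j, s.out j = if j ≤ i then link N j x else none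
  inn : ∀ j z, z ∈ s.inn j ↔ z ∈ N x ∧ link N j z = some x ∧ (j < i ∨ j = i ∧ 1 ≤ k)
  X : k = 0 → s.X = if _root_.unk N i x = ∅ then ∅ else {x}

variable {N}

theorem SpInv.send_eq {i k x : ℕ} {s : SpState} (h : SpInv N i k x s) (hk : k ≤ 2 * i + 1) (y : ℕ) :
    (s.send y = some s.X ∧ (k ≤ i ∧ link N (i - k) x = some y ∨
      i < k ∧ y ∈ N x ∧ link N (k - i - 1) y = some x)) ∨
    (s.send y = none ∧ (s.X = ∅ ∨ ¬ (k ≤ i ∧ link N (i - k) x = some y ∨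
      i < k ∧ y ∈ N x ∧ link N (k - i - 1) y = some x))) := by
  simp only [SpState.send, h.hi, h.hk, h.out, h.inn]
  by_cases hX : s.X = ∅
  · exact Or.inr ⟨if_pos hX, Or.inl hX⟩
  rw [if_neg hX]
  rcases le_or_gt k i with h2 | h2
  · rw [if_pos h2, if_pos (Nat.sub_le i k)]
    by_cases hl : link N (i - k) x = some y
    · exact Or.inl ⟨if_pos hl, Or.inl ⟨h2, hl⟩⟩
    · refine Or.inr ⟨if_neg hl, Or.inr ?_⟩
      rintro (h3 | h3)
      exacts [hl h3.2, h2.not_gt h3.1]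
  · have h1 : k - i - 1 < i ∨ k - i - 1 = i ∧ 1 ≤ k := by omega
    rw [if_neg (not_le.2 h2)]
    by_cases hl : y ∈ N x ∧ link N (k - i - 1) y = some x
    · exact Or.inl ⟨if_pos ⟨hl.1, hl.2, h1⟩, Or.inr ⟨h2, hl⟩⟩
    · refine Or.inr ⟨if_neg fun h3 => hl ⟨h3.1, h3.2.1⟩, Or.inr ?_⟩
      rintro (h3 | h3)
      exacts [h2.not_ge h3.1, hl h3.2]

/-- Silence and an empty set of rumors have the same effect here, so whether the sender has anything
to say drops out. -/
theorem mem_spInbox {i k x y v : ℕ} {s : ℕ → SpState} (h : ∀ x, SpInv N i k x (s x))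
    (hk : k ≤ 2 * i + 1) :
    v ∈ (spInbox N s x y).getD ∅ ↔ y ∈ N x ∧ v ∈ (s y).X ∧
      (k ≤ i ∧ link N (i - k) y = some x ∨
        i < k ∧ x ∈ N y ∧ link N (k - i - 1) x = some y) := by
  rw [spInbox]
  split_ifs with h1
  · rcases (h y).send_eq hk x with ⟨h2, h3⟩ | ⟨h2, h3 | h3⟩ <;> simp [h1, h2, h3]
  · simp [h1]

/-- In the first round of an iteration a node holds a rumor exactly if it has a link to choose.
Receiving a message therefore reveals precisely who chose `x`, which is how `inn` is learned. -/
theorem spInbox_ne_none_iff {i x y : ℕ} {s : ℕ → SpState} (h : ∀ x, SpInv N i 0 x (s x)) :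
    spInbox N s x y ≠ none ↔ y ∈ N x ∧ link N i y = some x := by
  have hy := h y
  have hX := hy.X rfl
  simp only [spInbox, SpState.send, hy.hi, hy.hk, hy.out, Nat.zero_le, Nat.sub_zero, le_refl,
    if_true, hX]
  by_cases h1 : y ∈ N x
  · by_cases h2 : unk N i y = ∅
    · simp [h1, h2, link, pick_empty]
    · by_cases h3 : link N i y = some x <;> simp [h1, h2, h3]
  · simp [h1]

theorem newInn_iff {i k x : ℕ} {s : ℕ → SpState} (h : ∀ x, SpInv N i k x (s x)) (j z : ℕ) :
    z ∈ (s x).newInn (spInbox N s x) j ↔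
      z ∈ N x ∧ link N j z = some x ∧ (j < i ∨ j = i ∧ 1 ≤ k + 1) := by
  have hx := h x
  simp only [SpState.newInn, hx.hi, hx.hk, hx.nbr]
  split_ifs with h1
  · obtain ⟨rfl, rfl⟩ := h1
    rw [Finset.mem_filter, spInbox_ne_none_iff h]
    simp only [lt_irrefl, false_or, Nat.zero_add, le_refl, and_true]
    tauto
  · rw [hx.inn]
    have : (j < i ∨ j = i ∧ 1 ≤ k) ↔ (j < i ∨ j = i ∧ 1 ≤ k + 1) := by omega
    rw [this]

theorem spInv {i k : ℕ} (hk : k ≤ 2 * i + 1) (x : ℕ) : SpInv N i k x (sp N (iterStart i + k) x) := by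
  have step : ∀ i k, k < 2 * i + 1 → (∀ x, SpInv N i k x (sp N (iterStart i + k) x)) →
      ∀ x, SpInv N i (k + 1) x (sp N (iterStart i + (k + 1)) x) := by
    intro i k hk h x
    have hx := h x
    have hk' : (sp N (iterStart i + k) x).k ≠ 2 * (sp N (iterStart i + k) x).i + 1 := by
      rw [hx.hi, hx.hk]; omega
    rw [← add_assoc, sp, SpState.recv, if_neg hk']
    exact ⟨hx.me, hx.hi, by simp [hx.hk], hx.nbr, hx.unk, hx.out, newInn_iff h, by simp⟩
  have iter : ∀ i, (∀ x, SpInv N i 0 x (sp N (iterStart i + 0) x)) → ∀ k, k ≤ 2 * i + 1 →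
      ∀ x, SpInv N i k x (sp N (iterStart i + k) x) := by
    intro i h k hk
    induction k with
    | zero => exact h
    | succ k ih => exact step i k hk (ih (by omega))
  suffices h : ∀ i x, SpInv N i 0 x (sp N (iterStart i + 0) x) from iter i (h i) k hk x
  intro i
  induction i with
  | zero =>
    intro x
    refine ⟨rfl, rfl, rfl, rfl, rfl, fun j => ?_, fun j z => ?_, fun _ => rfl⟩
    · change (if j = 0 then pick (N x) else none) = _
      by_cases hj : j = 0
      · subst hj; rfl
      · simp [hj]
    · change z ∈ (∅ : Finset ℕ) ↔ _
      simp
  | succ i ih =>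
    intro x
    have h := iter i ih (2 * i + 1) le_rfl
    have hx := h x
    have hk' : (sp N (iterStart i + (2 * i + 1)) x).k =
        2 * (sp N (iterStart i + (2 * i + 1)) x).i + 1 := by rw [hx.hi, hx.hk]
    have hs : sp N (iterStart (i + 1)) x = (sp N (iterStart i + (2 * i + 1)) x).recv
        (spInbox N (sp N (iterStart i + (2 * i + 1))) x) := by rw [iterStart_succ, sp]
    have hu : unk N (i + 1) x = (sp N (iterStart i + (2 * i + 1)) x).unk \
        (sp N (iterStart i + (2 * i + 1)) x).merge
          (spInbox N (sp N (iterStart i + (2 * i + 1))) x) := by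
      rw [unk, hs, SpState.recv, if_pos hk']
    rw [add_zero, hs, SpState.recv, if_pos hk', ← hu]
    refine ⟨hx.me, by simp [hx.hi], rfl, hx.nbr, rfl, fun j => ?_, fun j z => ?_, fun _ => ?_⟩
    · simp only [hx.hi, hx.out]
      by_cases h1 : j = i + 1
      · subst h1; simp [link]
      · rw [if_neg h1]
        exact if_congr (by omega) rfl rfl
    · refine (newInn_iff h j z).trans ?_
      have : (j < i ∨ j = i ∧ 1 ≤ 2 * i + 1 + 1) ↔ (j < i + 1 ∨ j = i + 1 ∧ 1 ≤ 0) := by omega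
      rw [this]
    · simp only [hx.me]

theorem X_succ {i k : ℕ} (hk : k < 2 * i + 1) (x : ℕ) :
    (sp N (iterStart i + (k + 1)) x).X = rumors N (iterStart i + k) x := by
  have hx := spInv (N := N) hk.le x
  have hk' : (sp N (iterStart i + k) x).k ≠ 2 * (sp N (iterStart i + k) x).i + 1 := by
    rw [hx.hi, hx.hk]; omega
  rw [← add_assoc, sp, SpState.recv, if_neg hk', rumors]

theorem unk_succ (i x : ℕ) :
    unk N (i + 1) x = unk N i x \ rumors N (iterStart i + (2 * i + 1)) x := by
  have hx := spInv (N := N) (i := i) le_rfl x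
  have hk' : (sp N (iterStart i + (2 * i + 1)) x).k =
      2 * (sp N (iterStart i + (2 * i + 1)) x).i + 1 := by rw [hx.hi, hx.hk]
  rw [← hx.unk, unk, iterStart_succ, sp, SpState.recv, if_pos hk', rumors]

theorem unk_subset (i x : ℕ) : unk N i x ⊆ N x := by
  induction i with
  | zero => exact subset_rfl
  | succ i ih => rw [unk_succ]; exact Finset.sdiff_subset.trans ih

theorem unk_anti {i j : ℕ} (h : i ≤ j) (x : ℕ) : unk N j x ⊆ unk N i x := by
  induction h with
  | refl => exact subset_rfl
  | step _ ih => rw [unk_succ]; exact Finset.sdiff_subset.trans ih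

theorem mem_of_link {i x y : ℕ} (h : link N i x = some y) : y ∈ unk N i x := mem_of_pick h

theorem mem_rumors {i k : ℕ} (hN : ∀ x y, y ∈ N x → x ∈ N y) (hk : k ≤ 2 * i + 1) {x v : ℕ} :
    v ∈ rumors N (iterStart i + k) x ↔ v ∈ (sp N (iterStart i + k) x).X ∨
      ∃ y, v ∈ (sp N (iterStart i + k) y).X ∧ (k ≤ i ∧ link N (i - k) y = some x ∨
        i < k ∧ link N (k - i - 1) x = some y) := by
  have hx := spInv (N := N) hk x
  rw [rumors, SpState.merge, Finset.mem_union, Finset.mem_biUnion, hx.nbr]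
  simp only [mem_spInbox (spInv hk) hk]
  refine or_congr_right (exists_congr fun y => ?_)
  have h2 : link N (i - k) y = some x → y ∈ N x := fun h =>
    hN _ _ (unk_subset _ _ (mem_of_link h))
  have h3 : link N (k - i - 1) x = some y → y ∈ N x := fun h => unk_subset _ _ (mem_of_link h)
  constructor
  · rintro ⟨-, -, h1, h4 | ⟨h4, -, h5⟩⟩
    exacts [⟨h1, Or.inl h4⟩, ⟨h1, Or.inr ⟨h4, h5⟩⟩]
  · rintro ⟨h1, h4 | ⟨h4, h5⟩⟩
    exacts [⟨h2 h4.2, h2 h4.2, h1, Or.inl h4⟩,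
      ⟨h3 h5, h3 h5, h1, Or.inr ⟨h4, hN _ _ (h3 h5), h5⟩⟩]

theorem mem_btree_succ {j x w : ℕ} :
    w ∈ btree N (j + 1) x ↔ w ∈ btree N j x ∨ ∃ u, link N j x = some u ∧ w ∈ btree N j u := by
  rw [btree, Finset.mem_union]
  cases link N j x <;> simp

/-- The invariant of the outward half: a node that still has links `i - k, …, 0` ahead stands for
the tree of order `i + 1 - k` hanging on it, and the union of these trees over all holders of the
rumor does not change. -/
theorem push_aux (hN : ∀ x y, y ∈ N x → x ∈ N y) (i k : ℕ) (hk : k ≤ i + 1) (v w : ℕ) :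
    (∃ z, v ∈ (sp N (iterStart i + k) z).X ∧ w ∈ btree N (i + 1 - k) z) ↔
      (unk N i v ≠ ∅ ∧ w ∈ btree N (i + 1) v) := by
  induction k with
  | zero =>
    have h : ∀ z, v ∈ (sp N (iterStart i + 0) z).X ↔ (unk N i v ≠ ∅ ∧ v = z) := by
      intro z
      rw [(spInv (N := N) (Nat.zero_le _) z).X rfl]
      split_ifs with h1
      · simp only [Finset.notMem_empty, false_iff, not_and]
        rintro h2 rfl
        exact h2 h1
      · rw [Finset.mem_singleton]
        refine ⟨?_, And.right⟩
        rintro rfl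
        exact ⟨h1, rfl⟩
    simp only [h, Nat.sub_zero]
    constructor
    · rintro ⟨z, ⟨h1, rfl⟩, h2⟩
      exact ⟨h1, h2⟩
    · rintro ⟨h1, h2⟩
      exact ⟨v, ⟨h1, rfl⟩, h2⟩
  | succ k ih =>
    rw [← ih (by omega)]
    have e : i + 1 - k = (i - k) + 1 := by omega
    have e' : i + 1 - (k + 1) = i - k := by omega
    have hik : ¬ i < k := by omega
    have hki : k ≤ i := by omega
    simp only [X_succ (N := N) (i := i) (k := k) (by omega), mem_rumors hN (i := i) (k := k) (by omega),
      e, e', mem_btree_succ, hik, hki, false_and, or_false, true_and]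
    constructor
    · rintro ⟨z, h1 | ⟨y, h1, h2⟩, h3⟩
      · exact ⟨z, h1, Or.inl h3⟩
      · exact ⟨y, h1, Or.inr ⟨z, h2, h3⟩⟩
    · rintro ⟨z, h1, h3 | ⟨u, h2, h3⟩⟩
      · exact ⟨z, Or.inl h1, h3⟩
      · exact ⟨u, Or.inr ⟨z, h1, h2⟩, h3⟩

theorem mem_X_push (hN : ∀ x y, y ∈ N x → x ∈ N y) (i v w : ℕ) :
    v ∈ (sp N (iterStart i + (i + 1)) w).X ↔ (unk N i v ≠ ∅ ∧ w ∈ btree N (i + 1) v) := by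
  rw [← push_aux hN i (i + 1) le_rfl, Nat.sub_self]
  simp [btree]

/-- The order of the links matters: when link `j` is used backwards, its far end `y` has already
gathered `btree N j y`, the half that `btree N (j + 1) x` gains. -/
theorem mem_X_pull (hN : ∀ x y, y ∈ N x → x ∈ N y) (i j : ℕ) (hj : j ≤ i) (v x : ℕ) :
    v ∈ (sp N (iterStart i + (i + 1 + j)) x).X ↔
      ∃ w ∈ btree N j x, v ∈ (sp N (iterStart i + (i + 1)) w).X := by
  induction j generalizing x with
  | zero => simp [btree]
  | succ j ih =>
    have h1 : ¬ i + 1 + j ≤ i := by omega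
    have h2 : i < i + 1 + j := by omega
    have h3 : i + 1 + j - i - 1 = j := by omega
    have h := X_succ (N := N) (i := i) (k := i + 1 + j) (by omega) x
    rw [← add_assoc (i + 1) j 1, h, mem_rumors hN (by omega)]
    simp only [h1, h2, h3, false_and, false_or, true_and, ih (by omega), mem_btree_succ]
    constructor
    · rintro (⟨w, hw, hv⟩ | ⟨y, ⟨w, hw, hv⟩, hy⟩)
      · exact ⟨w, Or.inl hw, hv⟩
      · exact ⟨w, Or.inr ⟨y, hy, hw⟩, hv⟩
    · rintro ⟨w, hw | ⟨y, hy, hw⟩, hv⟩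
      · exact Or.inl ⟨w, hw, hv⟩
      · exact Or.inr ⟨y, ⟨w, hw, hv⟩, hy⟩

/-- At the end of an iteration a node knows the rumor of another one if and only if their trees
meet. -/
theorem mem_rumors_last (hN : ∀ x y, y ∈ N x → x ∈ N y) (i v x : ℕ) :
    v ∈ rumors N (iterStart i + (2 * i + 1)) x ↔
      unk N i v ≠ ∅ ∧ ∃ w, w ∈ btree N (i + 1) v ∧ w ∈ btree N (i + 1) x := by
  have h0 : 2 * i + 1 = i + 1 + i := by ring
  have h1 : ¬ i + 1 + i ≤ i := by omega
  have h2 : i < i + 1 + i := by omega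
  have h3 : i + 1 + i - i - 1 = i := by omega
  rw [mem_rumors hN le_rfl, h0]
  simp only [h1, h2, h3, false_and, false_or, true_and, mem_X_pull hN i i le_rfl, mem_X_push hN]
  constructor
  · rintro (⟨w, hw, hv, hv'⟩ | ⟨y, ⟨w, hw, hv, hv'⟩, hy⟩)
    · exact ⟨hv, w, hv', mem_btree_succ.2 (Or.inl hw)⟩
    · exact ⟨hv, w, hv', mem_btree_succ.2 (Or.inr ⟨y, hy, hw⟩)⟩
  · rintro ⟨hv, w, hv', hw⟩
    obtain hw | ⟨y, hy, hw⟩ := mem_btree_succ.1 hw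
    · exact Or.inl ⟨w, hw, hv, hv'⟩
    · exact Or.inr ⟨y, ⟨w, hw, hv, hv'⟩, hy⟩

/-- The meeting of two trees is a symmetric relation; the extra condition that the rumor was started
holds for both ends, as each is unknown to the other. -/
theorem unk_symm (hN : ∀ x y, y ∈ N x → x ∈ N y) {i x y : ℕ} (h : y ∈ unk N i x) :
    x ∈ unk N i y := by
  induction i generalizing x y with
  | zero => exact hN _ _ h
  | succ i ih =>
    rw [unk_succ, Finset.mem_sdiff, mem_rumors_last hN] at h ⊢
    refine ⟨ih h.1, ?_⟩
    rintro ⟨-, w, h1, h2⟩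
    exact h.2 ⟨Finset.ne_empty_of_mem (ih h.1), w, h2, h1⟩

/-- Had the trees met, the rumor would have arrived in the previous iteration. -/
theorem disjoint_btree {U : Finset ℕ} (hN : IsNet N U) {i x y : ℕ} (h : y ∈ unk N i x) :
    Disjoint (btree N i x) (btree N i y) := by
  cases i with
  | zero =>
    rw [btree, btree, Finset.disjoint_singleton]
    rintro rfl
    exact hN.irrefl _ h
  | succ i =>
    rw [unk_succ, Finset.mem_sdiff, mem_rumors_last hN.symm] at h
    rw [Finset.disjoint_left]
    intro w h1 h2
    exact h.2 ⟨Finset.ne_empty_of_mem (unk_symm hN.symm h.1), w, h2, h1⟩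

/-- The tree of order `i + 1` is the union of two trees of order `i` hanging on neighbors unknown to
each other, hence disjoint. The chosen neighbor is active as well, by symmetry, so induction applies
to both. -/
theorem card_btree {U : Finset ℕ} (hN : IsNet N U) {i x : ℕ} (h : unk N i x ≠ ∅) :
    (btree N (i + 1) x).card = 2 ^ (i + 1) := by
  have key : ∀ y, unk N i y ≠ ∅ → (btree N i y).card = 2 ^ i := by
    cases i with
    | zero => intro y _; rfl
    | succ i =>
      intro y hy
      refine card_btree hN fun h0 => hy ?_
      exact Finset.subset_empty.1 (h0 ▸ unk_anti (Nat.le_succ i) y)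
  obtain ⟨y, hy⟩ := exists_pick (Finset.nonempty_iff_ne_empty.2 h)
  have hy' := mem_of_pick hy
  have : btree N (i + 1) x = btree N i x ∪ btree N i y := by
    rw [btree, link, hy]; rfl
  rw [this, Finset.card_union_of_disjoint (disjoint_btree hN hy'), key x h,
    key y (Finset.ne_empty_of_mem (unk_symm hN.symm hy')), pow_succ]
  ring

theorem btree_subset {U : Finset ℕ} (hN : IsNet N U) {i x : ℕ} (h : x ∈ U) :
    btree N i x ⊆ U := by
  induction i generalizing x with
  | zero => simpa [btree] using h
  | succ i ih =>
    intro w hw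
    obtain hw | ⟨y, hy, hw⟩ := mem_btree_succ.1 hw
    · exact ih h hw
    · exact ih (hN.sub _ (unk_subset _ _ (mem_of_link hy))) hw

/-- After `log₂ n` iterations all neighbors are known. -/
theorem unk_eq_empty {U : Finset ℕ} (hN : IsNet N U) {i x : ℕ} (hi : Nat.log 2 U.card ≤ i) :
    unk N i x = ∅ := by
  by_contra h
  obtain ⟨y, hy⟩ := Finset.nonempty_iff_ne_empty.2 h
  have hx : x ∈ U := hN.sub y (hN.symm _ _ (unk_subset _ _ hy))
  have h1 := Finset.card_le_card (btree_subset hN (i := i + 1) hx)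
  rw [card_btree hN h] at h1
  have h2 := Nat.le_log_of_pow_le (by norm_num) h1
  omega

/-! ### Local knowledge, stretch, size and message cost of the spanner -/

variable (N) in
open Classical in
/-- The edges of the spanner at `x`. -/
noncomputable def spanner (x : ℕ) : Finset ℕ :=
  (N x).filter fun y => ∃ j, link N j x = some y ∨ link N j y = some x

theorem mem_spanner_of_link (hN : ∀ x y, y ∈ N x → x ∈ N y) {j x y : ℕ}
    (h : link N j x = some y) : y ∈ spanner N x ∧ x ∈ spanner N y := by
  have h1 := unk_subset _ _ (mem_of_link h)
  simp only [spanner, Finset.mem_filter]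
  exact ⟨⟨h1, j, Or.inl h⟩, hN _ _ h1, j, Or.inr h⟩

theorem mem_spanner {x y : ℕ} : y ∈ spanner N x ↔
    y ∈ N x ∧ ∃ j, link N j x = some y ∨ link N j y = some x := by
  classical
  simp [spanner]

theorem spanner_isNet {U : Finset ℕ} (hN : IsNet N U) : IsNet (spanner N) U where
  sub x y h := hN.sub x (mem_spanner.1 h).1
  symm x y h := by
    rw [mem_spanner] at h ⊢
    obtain ⟨h, j, hj⟩ := h
    exact ⟨hN.symm _ _ h, j, hj.symm⟩
  irrefl x h := hN.irrefl x (mem_spanner.1 h).1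

theorem links_subset (t x : ℕ) : (sp N t x).links ⊆ spanner N x := by
  obtain ⟨i, k, hk, rfl⟩ := exists_iterStart t
  have hx := spInv (N := N) hk x
  intro y hy
  simp only [SpState.links, Finset.mem_filter, hx.nbr, hx.inn, hx.out] at hy
  obtain ⟨hy, j, hj⟩ := hy
  simp only [spanner, Finset.mem_filter]
  refine ⟨hy, j, ?_⟩
  split_ifs at hj with h
  · tauto
  · rcases hj with hj | hj
    · cases hj
    · exact Or.inr hj.2.1

/-- By symmetry of `unk`, a node without unknown neighbors is itself unknown to none of them, so it
neither chooses nor receives further links. It can thus tell locally that its list is complete. -/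
theorem links_eq (hN : ∀ x y, y ∈ N x → x ∈ N y) {t x : ℕ} (h : (sp N t x).unk = ∅) :
    (sp N t x).links = spanner N x := by
  refine (links_subset t x).antisymm ?_
  obtain ⟨i, k, hk, rfl⟩ := exists_iterStart t
  have hx := spInv (N := N) hk x
  rw [hx.unk] at h
  have h0 : ∀ j y, y ∈ unk N j x → j < i := by
    intro j y hy
    by_contra! hij
    simpa [h] using unk_anti hij x hy
  intro y hy
  simp only [SpState.links, Finset.mem_filter, hx.nbr, hx.inn, hx.out]
  simp only [spanner, Finset.mem_filter] at hy
  obtain ⟨hy, j, hj | hj⟩ := hy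
  · refine ⟨hy, j, Or.inl ?_⟩
    rwa [if_pos (h0 j y (mem_of_link hj)).le]
  · exact ⟨hy, j, Or.inr ⟨hy, hj, Or.inl (h0 j y (unk_symm hN (mem_of_link hj)))⟩⟩

/-- Needed for termination: the rumor protocol never uses an edge outside the spanner. -/
theorem mem_spanner_of_send (hN : ∀ x y, y ∈ N x → x ∈ N y) {t x y : ℕ}
    (h : (sp N t x).send y ≠ none) : y ∈ spanner N x := by
  obtain ⟨i, k, hk, rfl⟩ := exists_iterStart t
  rcases (spInv (N := N) hk x).send_eq hk y with ⟨-, h1 | h1⟩ | ⟨h1, -⟩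
  · exact (mem_spanner_of_link hN h1.2).1
  · exact (mem_spanner_of_link hN h1.2.2).2
  · exact absurd h1 h

theorem unk_mono_time {s t x : ℕ} (hst : s ≤ t) (h : (sp N s x).unk = ∅) :
    (sp N t x).unk = ∅ := by
  obtain ⟨i, k, hk, rfl⟩ := exists_iterStart s
  obtain ⟨j, l, hl, rfl⟩ := exists_iterStart t
  rw [(spInv (N := N) hk x).unk] at h
  rw [(spInv (N := N) hl x).unk]
  have : i ≤ j := iterStart_le hl rfl (by omega)
  exact Finset.subset_empty.1 (h ▸ unk_anti this x)

theorem unk_time_eq_empty {U : Finset ℕ} (hN : IsNet N U) {t x : ℕ}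
    (ht : iterStart (Nat.log 2 U.card) ≤ t) : (sp N t x).unk = ∅ := by
  obtain ⟨i, k, hk, rfl⟩ := exists_iterStart t
  rw [(spInv (N := N) hk x).unk]
  exact unk_eq_empty hN (iterStart_le hk rfl ht)

theorem within_of_mem_btree (hN : ∀ x y, y ∈ N x → x ∈ N y) {j x w : ℕ} (h : w ∈ btree N j x) :
    within (spanner N) j x w := by
  induction j generalizing x with
  | zero => exact (Finset.mem_singleton.1 h).symm
  | succ j ih =>
    obtain hw | ⟨y, hy, hw⟩ := mem_btree_succ.1 h
    · exact (ih hw).succ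
    · have := (within.single (mem_spanner_of_link hN hy).1).trans (ih hw)
      rwa [add_comm] at this

/-- When `y` becomes known to `x` in iteration `i`, both trees of order `i + 1` share a node, at
distance at most `i + 1` from either end. -/
theorem spanner_stretch {U : Finset ℕ} (hN : IsNet N U) {x y : ℕ} (h : y ∈ N x) :
    within (spanner N) (2 * Nat.log 2 U.card) x y := by
  have key : ∀ i, y ∈ unk N i x ∨ within (spanner N) (2 * i) x y := by
    intro i
    induction i with
    | zero => exact Or.inl h
    | succ i ih =>
      obtain ih | ih := ih
      · by_cases h1 : y ∈ unk N (i + 1) x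
        · exact Or.inl h1
        · rw [unk_succ, Finset.mem_sdiff, mem_rumors_last hN.symm, not_and, not_not] at h1
          obtain ⟨-, w, hy, hx⟩ := h1 ih
          right
          have := (within_of_mem_btree hN.symm hx).trans
            ((within_of_mem_btree hN.symm hy).symm (spanner_isNet hN).symm)
          exact this.mono (by omega)
      · exact Or.inr (ih.mono (by omega))
  refine (key _).resolve_left ?_
  rw [unk_eq_empty hN le_rfl]
  exact Finset.notMem_empty y

theorem link_lt {U : Finset ℕ} (hN : IsNet N U) {j x y : ℕ} (h : link N j x = some y) :
    j < Nat.log 2 U.card := by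
  by_contra! h1
  have := mem_of_link h
  rw [unk_eq_empty hN h1] at this
  exact Finset.notMem_empty y this

theorem sum_card_spanner_le {U : Finset ℕ} (hN : IsNet N U) :
    ∑ x ∈ U, (spanner N x).card ≤ 2 * (U.card * Nat.log 2 U.card) := by
  classical
  rw [← Finset.card_sigma]
  set A := (U ×ˢ Finset.range (Nat.log 2 U.card)) with hA
  have hcard : A.card = U.card * Nat.log 2 U.card := by simp [hA]
  -- Each pair of a node and an iteration accounts for at most one link, seen once from either end;
  -- this is the factor 2.
  have hsub : (U.sigma fun x => spanner N x) ⊆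
      A.image (fun p => (⟨p.1, (link N p.2 p.1).getD 0⟩ : (_ : ℕ) × ℕ)) ∪
      A.image (fun p => (⟨(link N p.2 p.1).getD 0, p.1⟩ : (_ : ℕ) × ℕ)) := by
    rintro ⟨x, y⟩ h
    simp only [Finset.mem_sigma, spanner, Finset.mem_filter] at h
    obtain ⟨hx, hy, j, hj | hj⟩ := h
    · refine Finset.mem_union_left _ (Finset.mem_image.2 ⟨(x, j), ?_, by simp [hj]⟩)
      simp [hA, hx, link_lt hN hj]
    · refine Finset.mem_union_right _ (Finset.mem_image.2 ⟨(y, j), ?_, by simp [hj]⟩)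
      simp [hA, hN.sub x hy, link_lt hN hj]
  refine (Finset.card_le_card hsub).trans ((Finset.card_union_le _ _).trans ?_)
  rw [two_mul, ← hcard]
  exact add_le_add Finset.card_image_le Finset.card_image_le

/-- From iteration `log₂ n` on no node starts a rumor, so there is nothing to forward. -/
theorem send_eq_none_of_unk {U : Finset ℕ} (hN : IsNet N U) {t : ℕ}
    (ht : iterStart (Nat.log 2 U.card) ≤ t) (x y : ℕ) : (sp N t x).send y = none := by
  have hX : ∀ i k, Nat.log 2 U.card ≤ i → k ≤ 2 * i + 1 → ∀ x, (sp N (iterStart i + k) x).X = ∅ := by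
    intro i k hi hk
    induction k with
    | zero =>
      intro x
      rw [(spInv (N := N) (Nat.zero_le _) x).X rfl, if_pos (unk_eq_empty hN hi)]
    | succ k ih =>
      intro x
      rw [X_succ (by omega)]
      ext v
      rw [mem_rumors hN.symm (by omega)]
      simp [ih (by omega)]
  obtain ⟨i, k, hk, rfl⟩ := exists_iterStart t
  rw [SpState.send, if_pos (hX i k (iterStart_le hk rfl ht) hk x)]

open Classical in
-- On the way out every node sends along a single link; on the way back every node receives along a
-- single link.
theorem card_sp_send_le {U : Finset ℕ} (t : ℕ) :
    ((U ×ˢ U).filter fun p : ℕ × ℕ => (sp N t p.1).send p.2 ≠ none).card ≤ U.card := by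
  obtain ⟨i, k, hk, rfl⟩ := exists_iterStart t
  have key : ∀ x y, (sp N (iterStart i + k) x).send y ≠ none →
      (k ≤ i ∧ link N (i - k) x = some y ∨ i < k ∧ link N (k - i - 1) y = some x) := by
    intro x y h
    rcases (spInv (N := N) hk x).send_eq hk y with ⟨-, h1 | h1⟩ | ⟨h1, -⟩
    exacts [Or.inl h1, Or.inr ⟨h1.1, h1.2.2⟩, absurd h1 h]
  by_cases hki : k ≤ i
  · apply Finset.card_le_card_of_injOn Prod.fst
    · intro p h
      exact (Finset.mem_product.1 (Finset.mem_filter.1 h).1).1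
    · rintro ⟨x, y⟩ h ⟨x', y'⟩ h' (rfl : x = x')
      have h1 := key _ _ (Finset.mem_filter.1 h).2
      have h2 := key _ _ (Finset.mem_filter.1 h').2
      simp only [hki, not_lt.2 hki, true_and, false_and, or_false] at h1 h2
      rw [h1] at h2; cases h2; rfl
  · apply Finset.card_le_card_of_injOn Prod.snd
    · intro p h
      exact (Finset.mem_product.1 (Finset.mem_filter.1 h).1).2
    · rintro ⟨x, y⟩ h ⟨x', y'⟩ h' (rfl : y = y')
      have h1 := key _ _ (Finset.mem_filter.1 h).2
      have h2 := key _ _ (Finset.mem_filter.1 h').2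
      simp only [hki, false_and, false_or] at h1 h2
      have h3 := h1.2.symm.trans h2.2
      cases h3; rfl

open Classical in
/-- The spanner construction sends at most `n (log₂ n) (log₂ n + 1)` messages. -/
theorem sum_card_sp_send_le {U : Finset ℕ} (hN : IsNet N U) (t : ℕ) :
    ∑ r ∈ Finset.range t,
      ((U ×ˢ U).filter fun p : ℕ × ℕ => (sp N r p.1).send p.2 ≠ none).card ≤
      U.card * iterStart (Nat.log 2 U.card) := by
  have h0 : ∀ r, ((U ×ˢ U).filter fun p : ℕ × ℕ => (sp N r p.1).send p.2 ≠ none).card ≤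
      if r < iterStart (Nat.log 2 U.card) then U.card else 0 := by
    intro r
    split_ifs with h
    · exact card_sp_send_le r
    · rw [Finset.filter_false_of_mem]
      · simp
      · intro p _
        simp [send_eq_none_of_unk hN (not_lt.1 h)]
  refine (Finset.sum_le_sum fun r _ => h0 r).trans ?_
  rw [← Finset.sum_filter, Finset.sum_const, smul_eq_mul, mul_comm]
  gcongr
  calc _ ≤ (Finset.range (iterStart (Nat.log 2 U.card))).card := by
        apply Finset.card_le_card
        intro r hr
        simp only [Finset.mem_filter] at hr
        simpa using hr.2
    _ = _ := Finset.card_range _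

end spanner

/-! ### Kingdoms: records and their update rules -/

/-- The position of a node in a kingdom: the root of the kingdom, the parent of the node in the tree
of the kingdom, and its depth. -/
structure Position where
  root : ℕ
  parent : ℕ
  dep : ℕ

/-- The public record of a node in the leader election.  In phase `p` the node has the position
`J p` in a kingdom; `E p` collects the roots of the kingdoms adjacent to the nodes below it; `F p`
is the value of `E p` at its root; and `D p` collects the values `F p` adjacent to the nodes below
it. -/
@[ext]
structure Rec where
  J : ℕ → Option Position
  E : ℕ → Option (Finset ℕ)
  F : ℕ → Option (Finset ℕ)
  D : ℕ → Option (Finset ℕ)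

namespace Rec

def empty : Rec := ⟨fun _ => none, fun _ => none, fun _ => none, fun _ => none⟩

/-- `r'` extends `r`. -/
structure Le (r r' : Rec) : Prop where
  J : ∀ {p j}, r.J p = some j → r'.J p = some j
  E : ∀ {p S}, r.E p = some S → r'.E p = some S
  F : ∀ {p S}, r.F p = some S → r'.F p = some S
  D : ∀ {p S}, r.D p = some S → r'.D p = some S

theorem Le.refl (r : Rec) : r.Le r := ⟨id, id, id, id⟩

theorem Le.trans {r r' r'' : Rec} (h : r.Le r') (h' : r'.Le r'') : r.Le r'' :=
  ⟨fun e => h'.J (h.J e), fun e => h'.E (h.E e), fun e => h'.F (h.F e), fun e => h'.D (h.D e)⟩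

/-- The node `v` with record `r` is a root in phase `p`. -/
def RootCond (v : ℕ) (r : Rec) : ℕ → Prop
  | 0 => True
  | p + 1 => r.J p = some ⟨v, v, 0⟩ ∧ ∃ S, r.D p = some S ∧ ∀ x ∈ S, x ≤ v

theorem RootCond.mono {v p : ℕ} {r r' : Rec} (h : r.Le r') (hr : r.RootCond v p) :
    r'.RootCond v p := by
  cases p with
  | zero => trivial
  | succ p =>
    obtain ⟨h1, S, h2, h3⟩ := hr
    exact ⟨h.J h1, S, h.D h2, h3⟩

/-- The node `v` with record `r` is the only root in some phase. -/
def Wins (v : ℕ) (r : Rec) : Prop := ∃ p, r.J p = some ⟨v, v, 0⟩ ∧ r.E p = some {v}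

theorem Wins.mono {v : ℕ} {r r' : Rec} (h : r.Le r') : r.Wins v → r'.Wins v := by
  rintro ⟨p, h1, h2⟩
  exact ⟨p, h.J h1, h.E h2⟩

end Rec

open Classical in
/-- The union of `own`, of the values `val` of the neighbors `N` and of the values `sub` of the
children among them, as soon as all these are present. -/
noncomputable def gather (N : Finset ℕ) (own : Option (Finset ℕ)) (val sub : ℕ → Option (Finset ℕ))
    (child : ℕ → Prop) : Option (Finset ℕ) :=
  own.bind fun S =>
    if ∀ w ∈ N, val w ≠ none ∧ (child w → sub w ≠ none) then
      some (S ∪ N.biUnion fun w => (val w).getD ∅ ∪ if child w then (sub w).getD ∅ else ∅)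
    else none

section gather
variable {N : Finset ℕ} {own : Option (Finset ℕ)} {val sub : ℕ → Option (Finset ℕ)}
  {child : ℕ → Prop}

theorem gather_eq_some {T : Finset ℕ} (h : gather N own val sub child = some T) :
    ∃ S, own = some S ∧ S ⊆ T ∧
      (∀ w ∈ N, ∃ Sw, val w = some Sw ∧ Sw ⊆ T ∧ (child w → ∃ S', sub w = some S' ∧ S' ⊆ T)) ∧
      ∀ x ∈ T, x ∈ S ∨ ∃ w ∈ N, (∃ Sw, val w = some Sw ∧ x ∈ Sw) ∨
        ∃ S', sub w = some S' ∧ x ∈ S' := by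
  classical
  obtain ⟨S, rfl⟩ : ∃ S, own = some S := by
    cases own with
    | none => cases h
    | some S => exact ⟨S, rfl⟩
  simp only [gather, Option.bind_some] at h
  split_ifs at h with hc
  cases h
  refine ⟨S, rfl, Finset.subset_union_left, fun w hw => ?_, fun x hx => ?_⟩
  · obtain ⟨h1, h2⟩ := hc w hw
    obtain ⟨Sw, hSw⟩ := Option.ne_none_iff_exists'.1 h1
    have hsub := Finset.subset_biUnion_of_mem
      (fun w => (val w).getD ∅ ∪ if child w then (sub w).getD ∅ else ∅) hw
    simp only [hSw, Option.getD_some] at hsub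
    refine ⟨Sw, hSw, (Finset.subset_union_left.trans hsub).trans Finset.subset_union_right,
      fun h3 => ?_⟩
    obtain ⟨S', hS'⟩ := Option.ne_none_iff_exists'.1 (h2 h3)
    rw [if_pos h3, hS'] at hsub
    exact ⟨S', hS', (Finset.subset_union_right.trans hsub).trans Finset.subset_union_right⟩
  · rw [Finset.mem_union, Finset.mem_biUnion] at hx
    refine hx.imp_right ?_
    rintro ⟨w, hw, hx⟩
    refine ⟨w, hw, (Finset.mem_union.1 hx).imp (fun hx => ?_) fun hx => ?_⟩
    · cases h1 : val w with
      | none => simp [h1] at hx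
      | some Sw => exact ⟨Sw, rfl, by simpa [h1] using hx⟩
    · split_ifs at hx
      · cases h1 : sub w with
        | none => simp [h1] at hx
        | some Sw => exact ⟨Sw, rfl, by simpa [h1] using hx⟩
      · simp at hx

theorem gather_ne_none (h : own ≠ none) (h' : ∀ w ∈ N, val w ≠ none ∧ (child w → sub w ≠ none)) :
    gather N own val sub child ≠ none := by
  obtain ⟨S, rfl⟩ := Option.ne_none_iff_exists'.1 h
  rw [gather, Option.bind_some, if_pos h']
  exact Option.some_ne_none _

end gather

open Classical in
/-- The new record of the node `v` with neighbors `N`, where `r` is its old record and `c` gives the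
old records of its neighbors. -/
noncomputable def Rec.update (v : ℕ) (N : Finset ℕ) (r : Rec) (c : ℕ → Rec) : Rec where
  J p := (r.J p).or <| if r.RootCond v p then some ⟨v, v, 0⟩ else
    (pick (N.filter fun w => (c w).J p ≠ none)).bind fun w =>
      ((c w).J p).map fun j => ⟨j.root, w, j.dep + 1⟩
  E p := (r.E p).or <| gather N ((r.J p).map fun j => {j.root})
    (fun w => ((c w).J p).map fun j => {j.root}) (fun w => (c w).E p)
    (fun w => ((c w).J p).map Position.parent = some v)
  F p := (r.F p).or <| (r.J p).bind fun j =>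
    -- A root that sees only itself hands nothing down, so its phase is the last one.
    if j.dep = 0 then (if r.E p = some {v} then none else r.E p) else (c j.parent).F p
  D p := (r.D p).or <| gather N (r.F p) (fun w => (c w).F p) (fun w => (c w).D p)
    (fun w => ((c w).J p).map Position.parent = some v)

open Classical in
/-- The records, restricted to the set `N`. -/
noncomputable def restrictRec (N : Finset ℕ) (s : ℕ → Rec) (w : ℕ) : Rec :=
  if w ∈ N then s w else Rec.empty

open Classical in
/-- The records after `t` rounds on the network `L`, where the node `x` takes part in round `t` if
`aw t x`. -/
noncomputable def erun (L : ℕ → Finset ℕ) (aw : ℕ → ℕ → Prop) : ℕ → ℕ → Rec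
  | 0, _ => Rec.empty
  | t + 1, x =>
    if aw t x then (erun L aw t x).update x (L x) (restrictRec (L x) (erun L aw t))
    else erun L aw t x

/-- The network `L` on `U` has diameter at most `K`, and the nodes that are awake stay awake and
include all of `U` from round `T₀` on. -/
structure ElectionSetup (L : ℕ → Finset ℕ) (U : Finset ℕ) (aw : ℕ → ℕ → Prop) (T₀ K : ℕ) :
    Prop where
  net : IsNet L U
  conn : ∀ x ∈ U, ∀ y ∈ U, within L K x y
  awU : ∀ {t x}, aw t x → x ∈ U
  awMono : ∀ {t x}, aw t x → aw (t + 1) x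
  awAll : ∀ {x}, x ∈ U → aw T₀ x

/-! ### Single rounds of the election -/

section election
variable {L : ℕ → Finset ℕ} {U : Finset ℕ} {aw : ℕ → ℕ → Prop} {T₀ K : ℕ}

theorem le_update (v : ℕ) (N : Finset ℕ) (r : Rec) (c : ℕ → Rec) : r.Le (r.update v N c) := by
  constructor <;> intro p a h <;> simp [Rec.update, h]

theorem erun_le_succ (t x : ℕ) : (erun L aw t x).Le (erun L aw (t + 1) x) := by
  rw [erun]
  split_ifs
  · exact le_update _ _ _ _
  · exact Rec.Le.refl _

theorem erun_le {s t : ℕ} (h : s ≤ t) (x : ℕ) : (erun L aw s x).Le (erun L aw t x) := by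
  induction h with
  | refl => exact Rec.Le.refl _
  | step _ ih => exact ih.trans (erun_le_succ _ _)

theorem ElectionSetup.aw_mono (h : ElectionSetup L U aw T₀ K) {s t x : ℕ} (hst : s ≤ t)
    (hx : aw s x) : aw t x := by
  induction hst with
  | refl => exact hx
  | step _ ih => exact h.awMono ih

theorem restrict_of_mem {N : Finset ℕ} {s : ℕ → Rec} {w : ℕ} (h : w ∈ N) :
    restrictRec N s w = s w := if_pos h

theorem J_succ {t v p : ℕ} {j : Position} (h : (erun L aw (t + 1) v).J p = some j) :
    (erun L aw t v).J p = some j ∨ aw t v ∧ ((j = ⟨v, v, 0⟩ ∧ (erun L aw t v).RootCond v p) ∨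
      ∃ w ∈ L v, ∃ jw, (erun L aw t w).J p = some jw ∧ j = ⟨jw.root, w, jw.dep + 1⟩) := by
  classical
  rw [erun] at h
  split_ifs at h with ha
  · rw [Rec.update, Option.or_eq_some_iff] at h
    refine h.imp_right fun ⟨_, h⟩ => ⟨ha, ?_⟩
    split_ifs at h with hr
    · cases h; exact Or.inl ⟨rfl, hr⟩
    · rw [Option.bind_eq_some_iff] at h
      obtain ⟨w, hw, h⟩ := h
      rw [Option.map_eq_some_iff] at h
      obtain ⟨jw, h1, rfl⟩ := h
      have hw' := (Finset.mem_filter.1 (mem_of_pick hw)).1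
      rw [restrict_of_mem hw'] at h1
      exact Or.inr ⟨w, hw', jw, h1, rfl⟩
  · exact Or.inl h

theorem J_succ_ne_none {t v p : ℕ} (ha : aw t v) (h : (erun L aw t v).RootCond v p ∨
    ∃ w ∈ L v, (erun L aw t w).J p ≠ none) : (erun L aw (t + 1) v).J p ≠ none := by
  classical
  rw [erun, if_pos ha, Rec.update, ne_eq, Option.or_eq_none_iff, not_and_or]
  right
  by_cases hr : (erun L aw t v).RootCond v p
  · rw [if_pos hr]
    exact Option.some_ne_none _
  · rw [if_neg hr]
    obtain ⟨w, hw, h1⟩ := h.resolve_left hr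
    obtain ⟨w', hw'⟩ := exists_pick
      (s := (L v).filter fun w => (restrictRec (L v) (erun L aw t) w).J p ≠ none)
      ⟨w, Finset.mem_filter.2 ⟨hw, by rwa [restrict_of_mem hw]⟩⟩
    have h2 := (Finset.mem_filter.1 (mem_of_pick hw')).2
    rw [hw', Option.bind_some, Option.map_eq_none_iff]
    exact h2

theorem E_succ {t v p : ℕ} {S : Finset ℕ} (h : (erun L aw (t + 1) v).E p = some S) :
    (erun L aw t v).E p = some S ∨
    gather (L v) (((erun L aw t v).J p).map fun j => {j.root})
      (fun w => ((restrictRec (L v) (erun L aw t) w).J p).map fun j => {j.root})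
      (fun w => (restrictRec (L v) (erun L aw t) w).E p)
      (fun w => ((restrictRec (L v) (erun L aw t) w).J p).map Position.parent = some v) =
        some S := by
  rw [erun] at h
  split_ifs at h with ha
  · rw [Rec.update, Option.or_eq_some_iff] at h
    exact h.imp_right And.right
  · exact Or.inl h

theorem E_succ_ne_none {t v p : ℕ} (ha : aw t v) (h : (erun L aw t v).J p ≠ none)
    (h' : ∀ w ∈ L v, ∃ jw, (erun L aw t w).J p = some jw ∧
      (jw.parent = v → (erun L aw t w).E p ≠ none)) : (erun L aw (t + 1) v).E p ≠ none := by
  rw [erun, if_pos ha, Rec.update, ne_eq, Option.or_eq_none_iff, not_and_or]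
  right
  refine gather_ne_none (by simpa using h) fun w hw => ?_
  obtain ⟨jw, h1, h2⟩ := h' w hw
  rw [restrict_of_mem hw, h1]
  exact ⟨Option.some_ne_none _, fun h3 => h2 (Option.some_injective _ h3)⟩

theorem F_succ {t v p : ℕ} {S : Finset ℕ} (h : (erun L aw (t + 1) v).F p = some S) :
    (erun L aw t v).F p = some S ∨ ∃ j, (erun L aw t v).J p = some j ∧
      (j.dep = 0 ∧ (erun L aw t v).E p = some S ∧ S ≠ {v} ∨
       j.dep ≠ 0 ∧ j.parent ∈ L v ∧ (erun L aw t j.parent).F p = some S) := by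
  rw [erun] at h
  split_ifs at h with ha
  · rw [Rec.update, Option.or_eq_some_iff] at h
    refine h.imp_right fun ⟨_, h⟩ => ?_
    rw [Option.bind_eq_some_iff] at h
    obtain ⟨j, hj, h⟩ := h
    refine ⟨j, hj, ?_⟩
    split_ifs at h with h1 h2
    · refine Or.inl ⟨h1, h, ?_⟩
      rintro rfl
      exact h2 h
    · rw [restrictRec] at h
      split_ifs at h with h2
      · exact Or.inr ⟨h1, h2, h⟩
      · cases h
  · exact Or.inl h

theorem F_succ_ne_none {t v p : ℕ} {j : Position} (ha : aw t v) (hj : (erun L aw t v).J p = some j)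
    (h : j.dep = 0 ∧ (erun L aw t v).E p ≠ none ∧ (erun L aw t v).E p ≠ some {v} ∨
       j.dep ≠ 0 ∧ j.parent ∈ L v ∧ (erun L aw t j.parent).F p ≠ none) :
    (erun L aw (t + 1) v).F p ≠ none := by
  rw [erun, if_pos ha, Rec.update, ne_eq, Option.or_eq_none_iff, not_and_or]
  right
  rw [hj, Option.bind_some]
  rcases h with ⟨h1, h2, h3⟩ | ⟨h1, h2, h3⟩
  · rwa [if_pos h1, if_neg h3]
  · rwa [if_neg h1, restrict_of_mem h2]

theorem D_succ {t v p : ℕ} {S : Finset ℕ} (h : (erun L aw (t + 1) v).D p = some S) :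
    (erun L aw t v).D p = some S ∨
    gather (L v) ((erun L aw t v).F p) (fun w => (restrictRec (L v) (erun L aw t) w).F p)
      (fun w => (restrictRec (L v) (erun L aw t) w).D p)
      (fun w => ((restrictRec (L v) (erun L aw t) w).J p).map Position.parent = some v) =
        some S := by
  rw [erun] at h
  split_ifs at h with ha
  · rw [Rec.update, Option.or_eq_some_iff] at h
    exact h.imp_right And.right
  · exact Or.inl h

theorem D_succ_ne_none {t v p : ℕ} (ha : aw t v) (h : (erun L aw t v).F p ≠ none)
    (h' : ∀ w ∈ L v, (erun L aw t w).F p ≠ none ∧ ∃ jw, (erun L aw t w).J p = some jw ∧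
      (jw.parent = v → (erun L aw t w).D p ≠ none)) : (erun L aw (t + 1) v).D p ≠ none := by
  rw [erun, if_pos ha, Rec.update, ne_eq, Option.or_eq_none_iff, not_and_or]
  right
  refine gather_ne_none h fun w hw => ?_
  obtain ⟨h0, jw, h1, h2⟩ := h' w hw
  rw [restrict_of_mem hw, h1]
  exact ⟨h0, fun h3 => h2 (Option.some_injective _ h3)⟩

/-! ### Invariants of the records -/

/-- The relations between the records that hold at all times. -/
structure ElectionInv (L : ℕ → Finset ℕ) (U : Finset ℕ) (s : ℕ → Rec) : Prop where
  mem : ∀ {v p}, (s v).J p ≠ none → v ∈ U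
  J : ∀ {v p j}, (s v).J p = some j → (j = ⟨v, v, 0⟩ ∧ (s v).RootCond v p) ∨
    ∃ w ∈ L v, ∃ jw, (s w).J p = some jw ∧ j = ⟨jw.root, w, jw.dep + 1⟩
  E : ∀ {v p S}, (s v).E p = some S → (∃ j, (s v).J p = some j ∧ j.root ∈ S) ∧
    (∀ w ∈ L v, ∃ jw, (s w).J p = some jw ∧ jw.root ∈ S ∧
      (jw.parent = v → ∃ S', (s w).E p = some S' ∧ S' ⊆ S)) ∧
    ∀ x ∈ S, (s x).J p = some ⟨x, x, 0⟩
  F : ∀ {v p S}, (s v).F p = some S → ∃ j, (s v).J p = some j ∧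
    (s j.root).E p = some S ∧ S ≠ {j.root}
  D : ∀ {v p S}, (s v).D p = some S → (∃ S₀, (s v).F p = some S₀ ∧ S₀ ⊆ S) ∧
    (∀ w ∈ L v, ∃ Sw jw, (s w).F p = some Sw ∧ Sw ⊆ S ∧ (s w).J p = some jw ∧
      (jw.parent = v → ∃ S', (s w).D p = some S' ∧ S' ⊆ S)) ∧
    ∀ x ∈ S, (s x).J p = some ⟨x, x, 0⟩

theorem ElectionInv.root {s : ℕ → Rec} (h : ElectionInv L U s) {v p : ℕ} {j : Position}
    (hj : (s v).J p = some j) : (s j.root).J p = some ⟨j.root, j.root, 0⟩ := by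
  obtain ⟨d, hd⟩ : ∃ d, j.dep = d := ⟨_, rfl⟩
  induction d generalizing v j with
  | zero =>
    obtain ⟨rfl, -⟩ | ⟨w, hw, jw, hjw, rfl⟩ := h.J hj
    · exact hj
    · cases hd
  | succ d ih =>
    obtain ⟨rfl, -⟩ | ⟨w, hw, jw, hjw, rfl⟩ := h.J hj
    · cases hd
    · exact ih (j := jw) hjw (Nat.succ_injective hd)

/-- Entries are never overwritten, so a relation needs checking only in the round that writes its
entry, where it refers to older entries that persist. -/
theorem electionInv (hs : ElectionSetup L U aw T₀ K) (t : ℕ) : ElectionInv L U (erun L aw t) := by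
  induction t with
  | zero => constructor <;> intro v p <;> simp [erun, Rec.empty]
  | succ t ih =>
    have hle := fun x => erun_le_succ (L := L) (aw := aw) t x
    constructor
    · intro v p h
      obtain ⟨j, hj⟩ := Option.ne_none_iff_exists'.1 h
      obtain h1 | ⟨h1, -⟩ := J_succ hj
      · exact ih.mem (h1 ▸ Option.some_ne_none _)
      · exact hs.awU h1
    · intro v p j hj
      have h1 : (j = ⟨v, v, 0⟩ ∧ (erun L aw t v).RootCond v p) ∨
          ∃ w ∈ L v, ∃ jw, (erun L aw t w).J p = some jw ∧ j = ⟨jw.root, w, jw.dep + 1⟩ := by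
        obtain h1 | ⟨-, h1⟩ := J_succ hj
        exacts [ih.J h1, h1]
      obtain ⟨h1, h2⟩ | ⟨w, hw, jw, h1, h2⟩ := h1
      · exact Or.inl ⟨h1, h2.mono (hle v)⟩
      · exact Or.inr ⟨w, hw, jw, (hle w).J h1, h2⟩
    · intro v p S hS
      obtain h1 | h1 := E_succ hS
      · obtain ⟨⟨j, h2, h3⟩, h4, h5⟩ := ih.E h1
        refine ⟨⟨j, (hle v).J h2, h3⟩, fun w hw => ?_, fun x hx => (hle x).J (h5 x hx)⟩
        obtain ⟨jw, h6, h7, h8⟩ := h4 w hw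
        refine ⟨jw, (hle w).J h6, h7, fun h9 => ?_⟩
        obtain ⟨S', h10, h11⟩ := h8 h9
        exact ⟨S', (hle w).E h10, h11⟩
      · obtain ⟨S₀, h2, h3, h4, h5⟩ := gather_eq_some h1
        obtain ⟨j, h6, rfl⟩ := Option.map_eq_some_iff.1 h2
        refine ⟨⟨j, (hle v).J h6, by simpa using h3⟩, fun w hw => ?_, fun x hx => ?_⟩
        · obtain ⟨Sw, h7, h8, h9⟩ := h4 w hw
          rw [restrict_of_mem hw] at h7 h9
          obtain ⟨jw, h10, rfl⟩ := Option.map_eq_some_iff.1 h7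
          refine ⟨jw, (hle w).J h10, by simpa using h8, fun h11 => ?_⟩
          rw [h10] at h9
          obtain ⟨S', h12, h13⟩ := h9 (by rw [← h11]; rfl)
          exact ⟨S', (hle w).E h12, h13⟩
        · obtain h7 | ⟨w, hw, ⟨Sw, h7, h8⟩ | ⟨S', h7, h8⟩⟩ := h5 x hx
          · rw [Finset.mem_singleton.1 h7]
            exact (hle _).J (ih.root h6)
          · rw [restrict_of_mem hw] at h7
            obtain ⟨jw, h10, rfl⟩ := Option.map_eq_some_iff.1 h7
            rw [Finset.mem_singleton.1 h8]
            exact (hle _).J (ih.root h10)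
          · rw [restrict_of_mem hw] at h7
            exact (hle _).J ((ih.E h7).2.2 x h8)
    · intro v p S hS
      obtain h1 | ⟨j, hj, ⟨h1, h2, h3⟩ | ⟨h1, h2, h3⟩⟩ := F_succ hS
      · obtain ⟨j, h2, h3, h4⟩ := ih.F h1
        exact ⟨j, (hle v).J h2, (hle _).E h3, h4⟩
      · refine ⟨j, (hle v).J hj, ?_⟩
        obtain ⟨rfl, -⟩ | ⟨w, hw, jw, -, rfl⟩ := ih.J hj
        · exact ⟨(hle v).E h2, h3⟩
        · cases h1
      · obtain ⟨j', h4, h5, h6⟩ := ih.F h3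
        refine ⟨j, (hle v).J hj, ?_⟩
        obtain ⟨rfl, -⟩ | ⟨w, hw, jw, h7, rfl⟩ := ih.J hj
        · exact absurd rfl h1
        · have : j' = jw := Option.some_injective _ (h4.symm.trans h7)
          subst this
          exact ⟨(hle _).E h5, h6⟩
    · intro v p S hS
      obtain h1 | h1 := D_succ hS
      · obtain ⟨⟨j, h2, h3⟩, h4, h5⟩ := ih.D h1
        refine ⟨⟨j, (hle v).F h2, h3⟩, fun w hw => ?_, fun x hx => (hle x).J (h5 x hx)⟩
        obtain ⟨Sw, jw, h6, h7, h8, h9⟩ := h4 w hw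
        refine ⟨Sw, jw, (hle w).F h6, h7, (hle w).J h8, fun h10 => ?_⟩
        obtain ⟨S', h11, h12⟩ := h9 h10
        exact ⟨S', (hle w).D h11, h12⟩
      · obtain ⟨S₀, h2, h3, h4, h5⟩ := gather_eq_some h1
        refine ⟨⟨S₀, (hle v).F h2, h3⟩, fun w hw => ?_, fun x hx => ?_⟩
        · obtain ⟨Sw, h7, h8, h9⟩ := h4 w hw
          rw [restrict_of_mem hw] at h7 h9
          obtain ⟨jw, h10, -⟩ := ih.F h7
          refine ⟨Sw, jw, (hle w).F h7, h8, (hle w).J h10, fun h11 => ?_⟩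
          rw [h10] at h9
          obtain ⟨S', h12, h13⟩ := h9 (by rw [← h11]; rfl)
          exact ⟨S', (hle w).D h12, h13⟩
        · have key : ∀ w Sw, (erun L aw t w).F p = some Sw → x ∈ Sw →
              (erun L aw t x).J p = some ⟨x, x, 0⟩ := by
            intro w Sw h6 h7
            obtain ⟨j, -, h8, -⟩ := ih.F h6
            exact (ih.E h8).2.2 x h7
          obtain h7 | ⟨w, hw, ⟨Sw, h7, h8⟩ | ⟨S', h7, h8⟩⟩ := h5 x hx
          · exact (hle x).J (key v S₀ h2 h7)
          · rw [restrict_of_mem hw] at h7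
            exact (hle x).J (key w Sw h7 h8)
          · rw [restrict_of_mem hw] at h7
            exact (hle _).J ((ih.D h7).2.2 x h8)

/-! ### Halving of the roots and uniqueness of the winner -/

section safety
variable {s : ℕ → Rec}

/-- A node fills `E` only after all its neighbors have positions and its children have reported.
Descending from the root, every member of the kingdom has therefore reported, and its set was
absorbed upwards. -/
theorem ElectionInv.E_of_root (h : ElectionInv L U s) (hL : IsNet L U) {c p : ℕ} {S : Finset ℕ}
    (hS : (s c).E p = some S) {x : ℕ} {j : Position} (hj : (s x).J p = some j) (hc : j.root = c) :
    ∃ S', (s x).E p = some S' ∧ S' ⊆ S := by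
  obtain ⟨d, hd⟩ : ∃ d, j.dep = d := ⟨_, rfl⟩
  induction d generalizing x j with
  | zero =>
    obtain ⟨rfl, -⟩ | ⟨w, hw, jw, hjw, rfl⟩ := h.J hj
    · cases hc; exact ⟨S, hS, subset_rfl⟩
    · cases hd
  | succ d ih =>
    obtain ⟨rfl, -⟩ | ⟨w, hw, jw, hjw, rfl⟩ := h.J hj
    · cases hd
    · obtain ⟨S', h1, h2⟩ := ih (j := jw) hjw hc (Nat.succ_injective hd)
      obtain ⟨jx, h3, -, h4⟩ := (h.E h1).2.1 x (hL.symm _ _ hw)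
      cases h3.symm.trans hj
      obtain ⟨S'', h5, h6⟩ := h4 rfl
      exact ⟨S'', h5, h6.trans h2⟩

theorem ElectionInv.D_of_root (h : ElectionInv L U s) (hL : IsNet L U) {c p : ℕ} {S : Finset ℕ}
    (hS : (s c).D p = some S) {x : ℕ} {j : Position} (hj : (s x).J p = some j) (hc : j.root = c) :
    ∃ S', (s x).D p = some S' ∧ S' ⊆ S := by
  obtain ⟨d, hd⟩ : ∃ d, j.dep = d := ⟨_, rfl⟩
  induction d generalizing x j with
  | zero =>
    obtain ⟨rfl, -⟩ | ⟨w, hw, jw, hjw, rfl⟩ := h.J hj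
    · cases hc; exact ⟨S, hS, subset_rfl⟩
    · cases hd
  | succ d ih =>
    obtain ⟨rfl, -⟩ | ⟨w, hw, jw, hjw, rfl⟩ := h.J hj
    · cases hd
    · obtain ⟨S', h1, h2⟩ := ih (j := jw) hjw hc (Nat.succ_injective hd)
      obtain ⟨-, jx, -, -, h3, h4⟩ := (h.D h1).2.1 x (hL.symm _ _ hw)
      cases h3.symm.trans hj
      obtain ⟨S'', h5, h6⟩ := h4 rfl
      exact ⟨S'', h5, h6.trans h2⟩

/-- A kingdom without foreign neighbors is the whole network. -/
theorem ElectionInv.root_eq_of_closed (hs : ElectionSetup L U aw T₀ K) {c p : ℕ}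
    (hc : (s c).J p = some ⟨c, c, 0⟩) (hcU : c ∈ U)
    (h : ∀ x j, (s x).J p = some j → j.root = c → ∀ y ∈ L x, ∃ jy, (s y).J p = some jy ∧
      jy.root = c) {y : ℕ} (hy : y ∈ U) : ∃ j, (s y).J p = some j ∧ j.root = c := by
  have key : ∀ k y, within L k c y → ∃ j, (s y).J p = some j ∧ j.root = c := by
    intro k
    induction k with
    | zero => rintro y rfl; exact ⟨_, hc, rfl⟩
    | succ k ih =>
      rintro y ⟨z, hz, rfl | hy⟩
      · exact ih _ hz
      · obtain ⟨j, h1, h2⟩ := ih _ hz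
        exact h z j h1 h2 y hy
  exact key K y (hs.conn c hcU y hy)

theorem ElectionInv.root_eq_of_E (h : ElectionInv L U s) (hs : ElectionSetup L U aw T₀ K) {c p : ℕ}
    (hc : (s c).J p = some ⟨c, c, 0⟩) (hE : (s c).E p = some {c}) {y : ℕ} (hy : y ∈ U) :
    ∃ j, (s y).J p = some j ∧ j.root = c := by
  refine root_eq_of_closed hs hc (h.mem (hc ▸ Option.some_ne_none _)) (fun x j h1 h2 y hy => ?_) hy
  obtain ⟨S', h3, h4⟩ := h.E_of_root hs.net hE h1 h2
  obtain ⟨jy, h5, h6, -⟩ := (h.E h3).2.1 y hy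
  exact ⟨jy, h5, by simpa using h4 h6⟩

/-- A root that survives a phase is the largest root adjacent to the kingdom of some root that does
not survive. -/
theorem ElectionInv.exists_loser (h : ElectionInv L U s) (hs : ElectionSetup L U aw T₀ K) {c p : ℕ}
    (hc : (s c).J (p + 1) = some ⟨c, c, 0⟩) :
    (s c).J p = some ⟨c, c, 0⟩ ∧ (s c).E p ≠ some {c} ∧
    ∃ d, (s d).J p = some ⟨d, d, 0⟩ ∧ (s d).J (p + 1) ≠ some ⟨d, d, 0⟩ ∧
      ∃ S, (s d).E p = some S ∧ c ∈ S ∧ ∀ z ∈ S, z ≤ c := by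
  have key : ∀ {c}, (s c).J (p + 1) = some ⟨c, c, 0⟩ → (s c).J p = some ⟨c, c, 0⟩ ∧
      ∃ S S₀, (s c).D p = some S ∧ (s c).E p = some S₀ ∧ S₀ ⊆ S ∧ S₀ ≠ {c} ∧ ∀ x ∈ S, x ≤ c := by
    intro c hc
    obtain ⟨-, h1, S, h2, h3⟩ | ⟨w, hw, jw, -, h1⟩ := h.J hc
    · obtain ⟨⟨S₀, h4, h5⟩, -⟩ := h.D h2
      obtain ⟨j, h6, h7, h8⟩ := h.F h4
      cases h1.symm.trans h6
      exact ⟨h1, S, S₀, h2, h7, h5, h8, h3⟩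
    · cases h1
  obtain ⟨h1, S, S₀, hD, hE, hS, hne, hle⟩ := key hc
  refine ⟨h1, fun h2 => hne (Option.some_injective _ (hE.symm.trans h2)), ?_⟩
  -- Some edge leaves the kingdom: otherwise it is the whole network, `c` is the only root and `S₀ =
  -- {c}`, in which case `F` would have been withheld.
  obtain ⟨x, j, y, jy, hx, hxc, hxy, hy, hyc⟩ : ∃ x j y jy, (s x).J p = some j ∧ j.root = c ∧
      y ∈ L x ∧ (s y).J p = some jy ∧ jy.root ≠ c := by
    by_contra! hcon
    have hcU : c ∈ U := h.mem (h1 ▸ Option.some_ne_none _)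
    refine hne ?_
    have hcl := fun y (hy : y ∈ U) => ElectionInv.root_eq_of_closed hs h1 hcU
      (fun x j h2 h3 y hy => by
        obtain ⟨S', h4, -⟩ := h.E_of_root hs.net hE h2 h3
        obtain ⟨jy, h5, -, -⟩ := (h.E h4).2.1 y hy
        exact ⟨jy, h5, hcon x j y jy h2 h3 hy h5⟩) hy
    obtain ⟨j, h2, h3⟩ := (h.E hE).1
    cases h1.symm.trans h2
    refine Finset.eq_singleton_iff_unique_mem.2 ⟨h3, fun d hd => ?_⟩
    have h4 := (h.E hE).2.2 d hd
    obtain ⟨j, h5, h6⟩ := hcl d (h.mem (h4 ▸ Option.some_ne_none _))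
    cases h4.symm.trans h5
    exact h6
  obtain ⟨Sx, hSx, hSx'⟩ := h.E_of_root hs.net hE hx hxc
  obtain ⟨jy', h2, hd, -⟩ := (h.E hSx).2.1 y hxy
  cases hy.symm.trans h2
  -- The root `d = jy.root` across the edge was reported to `c`, which survived as the maximum.
  have hdc : jy.root < c := lt_of_le_of_ne (hle _ (hS (hSx' hd))) hyc
  obtain ⟨Dx, hDx, hDx'⟩ := h.D_of_root hs.net hD hx hxc
  obtain ⟨Sy, jy', hFy, hSy, h3, -⟩ := (h.D hDx).2.1 y hxy
  cases hy.symm.trans h3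
  -- What `y` holds as `F` is the set `E` of its root `d`, so `c` has seen all of it.
  obtain ⟨jy', h4, hEd, -⟩ := h.F hFy
  cases hy.symm.trans h4
  obtain ⟨Ey, hEy, hEy'⟩ := h.E_of_root hs.net hEd hy rfl
  obtain ⟨jx', h5, h6, -⟩ := (h.E hEy).2.1 x (hs.net.symm _ _ hxy)
  cases hx.symm.trans h5
  -- The same edge, seen from `y`, reports `c` to `d`; since `c > d`, the root `d` cannot survive.
  have hcS : c ∈ Sy := hEy' (hxc ▸ h6)
  refine ⟨jy.root, h.root hy, fun h7 => ?_, Sy, hEd, hcS, fun z hz => hle z (hDx' (hSy hz))⟩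
  obtain ⟨-, S', S₀', -, hE', hS', -, hle'⟩ := key h7
  cases hEd.symm.trans hE'
  exact absurd (hle' c (hS' hcS)) (not_le.2 hdc)

variable (U s) in
open Classical in
/-- The roots of phase `p`. -/
noncomputable def roots (p : ℕ) : Finset ℕ := U.filter fun x => (s x).J p = some ⟨x, x, 0⟩

theorem ElectionInv.mem_roots (h : ElectionInv L U s) {p x : ℕ} :
    x ∈ roots U s p ↔ (s x).J p = some ⟨x, x, 0⟩ := by
  classical
  simp only [roots, Finset.mem_filter, and_iff_right_iff_imp]
  exact fun h1 => h.mem (h1 ▸ Option.some_ne_none _)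

theorem ElectionInv.roots_succ_subset (h : ElectionInv L U s) (hs : ElectionSetup L U aw T₀ K)
    (p : ℕ) : roots U s (p + 1) ⊆ roots U s p := by
  intro c hc
  rw [h.mem_roots] at hc ⊢
  exact (h.exists_loser hs hc).1

theorem ElectionInv.card_roots_succ (h : ElectionInv L U s) (hs : ElectionSetup L U aw T₀ K)
    (p : ℕ) : 2 * (roots U s (p + 1)).card ≤ (roots U s p).card := by
  classical
  choose! f h1 h2 S h3 h4 h5 using fun c hc => (h.exists_loser hs (c := c) (p := p) hc).2.2
  have hle : (roots U s (p + 1)).card ≤ (roots U s p \ roots U s (p + 1)).card := by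
    apply Finset.card_le_card_of_injOn f
    · intro c hc
      have hc := h.mem_roots.1 hc
      rw [Finset.coe_sdiff, Set.mem_sdiff, Finset.mem_coe, Finset.mem_coe, h.mem_roots, h.mem_roots]
      exact ⟨h1 c hc, h2 c hc⟩
    -- The loser recovers its survivor as the maximum of its own set `E`.
    · intro c hc c' hc' hcc
      have hc := h.mem_roots.1 hc
      have hc' := h.mem_roots.1 hc'
      have hS : S c = S c' := Option.some_injective _ ((h3 c hc).symm.trans (hcc ▸ h3 c' hc'))
      exact le_antisymm (h5 c' hc' c (hS ▸ h4 c hc)) (h5 c hc c' (hS ▸ h4 c' hc'))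
  rw [Finset.card_sdiff_of_subset (h.roots_succ_subset hs p)] at hle
  omega

theorem ElectionInv.two_pow_mul_card_roots (h : ElectionInv L U s)
    (hs : ElectionSetup L U aw T₀ K) (p : ℕ) : 2 ^ p * (roots U s p).card ≤ U.card := by
  induction p with
  | zero =>
    classical
    rw [pow_zero, one_mul]
    exact Finset.card_le_card (Finset.filter_subset _ _)
  | succ p ih =>
    calc 2 ^ (p + 1) * (roots U s (p + 1)).card = 2 ^ p * (2 * (roots U s (p + 1)).card) := by ring
      _ ≤ 2 ^ p * (roots U s p).card := Nat.mul_le_mul_left _ (h.card_roots_succ hs p)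
      _ ≤ _ := ih

/-- There are at most `log₂ n + 1` phases. -/
theorem ElectionInv.phase_lt (h : ElectionInv L U s) (hs : ElectionSetup L U aw T₀ K) {p v : ℕ}
    (hv : (s v).J p ≠ none) : p < Nat.log 2 U.card + 1 := by
  obtain ⟨j, hj⟩ := Option.ne_none_iff_exists'.1 hv
  have h1 : 0 < (roots U s p).card := Finset.card_pos.2 ⟨_, h.mem_roots.2 (h.root hj)⟩
  have h2 : 2 ^ p ≤ U.card :=
    (Nat.le_mul_of_pos_right _ h1).trans (h.two_pow_mul_card_roots hs p)
  exact Nat.lt_succ_of_le (Nat.le_log_of_pow_le (by norm_num) h2)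

theorem ElectionInv.roots_anti (h : ElectionInv L U s) (hs : ElectionSetup L U aw T₀ K) {p q : ℕ}
    (hpq : p ≤ q) : roots U s q ⊆ roots U s p := by
  induction hpq with
  | refl => exact subset_rfl
  | step _ ih => exact (h.roots_succ_subset hs _).trans ih

/-- A winner of phase `p` rules everyone, so a root of a later phase, being a root of phase `p` too,
would have to be that winner; but survivors have `E p ≠ {c}`. -/
theorem ElectionInv.wins_unique (h : ElectionInv L U s) (hs : ElectionSetup L U aw T₀ K) {v w : ℕ}
    (hv : (s v).Wins v) (hw : (s w).Wins w) : v = w := by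
  obtain ⟨p, hv, hvE⟩ := hv
  obtain ⟨q, hw, hwE⟩ := hw
  have lt : ∀ {v w p q}, (s v).J p = some ⟨v, v, 0⟩ → (s v).E p = some {v} →
      (s w).J q = some ⟨w, w, 0⟩ → ¬ p < q := by
    intro v w p q hv hvE hw hpq
    have h1 := h.mem_roots.1 (h.roots_anti hs (Nat.succ_le_of_lt hpq) (h.mem_roots.2 hw))
    obtain ⟨h2, h3, -⟩ := h.exists_loser hs h1
    obtain ⟨j, h4, h5⟩ := h.root_eq_of_E hs hv hvE (h.mem (hw ▸ Option.some_ne_none _))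
    cases h2.symm.trans h4
    cases h5
    exact h3 hvE
  have hpq : p = q := le_antisymm (not_lt.1 (lt hw hwE hv)) (not_lt.1 (lt hv hvE hw))
  subst hpq
  obtain ⟨j, h4, h5⟩ := h.root_eq_of_E hs hv hvE (h.mem (hw ▸ Option.some_ne_none _))
  cases hw.symm.trans h4
  exact h5.symm

end safety

theorem aw_of_J (hs : ElectionSetup L U aw T₀ K) {t v p : ℕ} (h : (erun L aw t v).J p ≠ none) :
    aw t v := by
  induction t with
  | zero => exact absurd rfl h
  | succ t ih =>
    obtain ⟨j, hj⟩ := Option.ne_none_iff_exists'.1 h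
    obtain h1 | ⟨h1, -⟩ := J_succ hj
    · exact hs.awMono (ih (h1 ▸ Option.some_ne_none _))
    · exact hs.awMono h1

/-- The kingdom of a winner is the whole network, and only nodes that are awake take a position. -/
theorem aw_of_wins (hs : ElectionSetup L U aw T₀ K) {t v x : ℕ} (h : (erun L aw t v).Wins v)
    (hx : x ∈ U) : aw t x := by
  obtain ⟨p, h1, h2⟩ := h
  obtain ⟨j, h3, -⟩ := (electionInv hs t).root_eq_of_E hs h1 h2 hx
  exact aw_of_J hs (p := p) (h3 ▸ Option.some_ne_none _)

theorem wins_unique (hs : ElectionSetup L U aw T₀ K) {t t' v w : ℕ}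
    (hv : (erun L aw t v).Wins v) (hw : (erun L aw t' w).Wins w) : v = w :=
  (electionInv hs (max t t')).wins_unique hs (hv.mono (erun_le (le_max_left _ _) _))
    (hw.mono (erun_le (le_max_right _ _) _))

/-! ### Number of changes of a record -/

section count

/-- The number of entries of a record in the phases below `P`. -/
def Rec.size (P : ℕ) (r : Rec) : ℕ :=
  ∑ p ∈ Finset.range P, ((r.J p).isSome.toNat + (r.E p).isSome.toNat + (r.F p).isSome.toNat +
    (r.D p).isSome.toNat)

theorem Rec.size_le (P : ℕ) (r : Rec) : r.size P ≤ 4 * P := by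
  have : ∀ p ∈ Finset.range P, ((r.J p).isSome.toNat + (r.E p).isSome.toNat +
      (r.F p).isSome.toNat + (r.D p).isSome.toNat) ≤ 4 := by
    intro p _
    have := (r.J p).isSome.toNat_le
    have := (r.E p).isSome.toNat_le
    have := (r.F p).isSome.toNat_le
    have := (r.D p).isSome.toNat_le
    omega
  refine (Finset.sum_le_sum this).trans ?_
  simp [mul_comm]

theorem toNat_isSome_le {α : Type*} {a b : Option α} (h : ∀ {x}, a = some x → b = some x) :
    a.isSome.toNat ≤ b.isSome.toNat := by
  cases a with
  | none => simp
  | some x => rw [h rfl]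

theorem toNat_isSome_lt {α : Type*} {a b : Option α} (h : ∀ {x}, a = some x → b = some x)
    (hne : a ≠ b) : a.isSome.toNat < b.isSome.toNat := by
  cases a with
  | none =>
    cases b with
    | none => exact absurd rfl hne
    | some x => simp
  | some x => exact absurd (h rfl).symm hne

theorem Rec.size_lt {P : ℕ} {r r' : Rec} (h : r.Le r') (hne : r ≠ r')
    (hP : ∀ p, P ≤ p → r'.J p = none ∧ r'.E p = none ∧ r'.F p = none ∧ r'.D p = none) :
    r.size P < r'.size P := by
  have none_of : ∀ {α : Type} {a b : Option α}, (∀ {x}, a = some x → b = some x) → b = none →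
      a = b := by
    intro α a b h1 h2
    cases a with
    | none => exact h2.symm
    | some x => exact (h1 rfl).symm
  refine Finset.sum_lt_sum (fun p _ => ?_) ?_
  · exact add_le_add (add_le_add (add_le_add (toNat_isSome_le h.J) (toNat_isSome_le h.E))
      (toNat_isSome_le h.F)) (toNat_isSome_le h.D)
  · by_contra! hcon
    refine hne ?_
    have key : ∀ p, r.J p = r'.J p ∧ r.E p = r'.E p ∧ r.F p = r'.F p ∧ r.D p = r'.D p := by
      intro p
      by_cases hp : P ≤ p
      · obtain ⟨h1, h2, h3, h4⟩ := hP p hp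
        exact ⟨none_of h.J h1, none_of h.E h2, none_of h.F h3, none_of h.D h4⟩
      · have h0 := hcon p (Finset.mem_range.2 (not_le.1 hp))
        have h1 := toNat_isSome_le (h.J (p := p))
        have h2 := toNat_isSome_le (h.E (p := p))
        have h3 := toNat_isSome_le (h.F (p := p))
        have h4 := toNat_isSome_le (h.D (p := p))
        refine ⟨?_, ?_, ?_, ?_⟩ <;> by_contra hn
        · have := toNat_isSome_lt h.J hn; omega
        · have := toNat_isSome_lt h.E hn; omega
        · have := toNat_isSome_lt h.F hn; omega
        · have := toNat_isSome_lt h.D hn; omega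
    ext1 <;> funext p
    exacts [(key p).1, (key p).2.1, (key p).2.2.1, (key p).2.2.2]

open Classical in
/-- The record of a node changes `O(log n)` times. -/
theorem card_changes_le (hs : ElectionSetup L U aw T₀ K) (v t : ℕ) :
    ((Finset.range t).filter fun r => erun L aw (r + 1) v ≠ erun L aw r v).card ≤
      4 * (Nat.log 2 U.card + 1) := by
  refine le_trans ?_ ((erun L aw t v).size_le _)
  induction t with
  | zero => simp
  | succ t ih =>
    rw [Finset.range_add_one, Finset.filter_insert]
    split_ifs with h
    · rw [Finset.card_insert_of_notMem (by simp)]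
      -- Every change fills a new entry, and all entries lie in phases below `log₂ n + 1`: the
      -- others require a position, which is impossible beyond.
      refine Nat.succ_le_of_lt (ih.trans_lt (Rec.size_lt (erun_le_succ t v) (Ne.symm h) ?_))
      intro p hp
      have inv := electionInv hs (t + 1)
      have hJ : (erun L aw (t + 1) v).J p = none := by
        by_contra hJ
        exact absurd (inv.phase_lt hs hJ) (not_lt.2 hp)
      have hF : (erun L aw (t + 1) v).F p = none := by
        by_contra hF
        obtain ⟨S, hS⟩ := Option.ne_none_iff_exists'.1 hF
        obtain ⟨j, hj, -⟩ := inv.F hS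
        cases hJ.symm.trans hj
      refine ⟨hJ, ?_, hF, ?_⟩
      · by_contra hE
        obtain ⟨S, hS⟩ := Option.ne_none_iff_exists'.1 hE
        obtain ⟨⟨j, hj, -⟩, -⟩ := inv.E hS
        cases hJ.symm.trans hj
      · by_contra hD
        obtain ⟨S, hS⟩ := Option.ne_none_iff_exists'.1 hD
        obtain ⟨⟨j, hj, -⟩, -⟩ := inv.D hS
        cases hF.symm.trans hj
    · rw [not_not] at h
      rwa [h]

end count

/-! ### Duration of the phases -/

section time

theorem J_ne_none_of_within (hs : ElectionSetup L U aw T₀ K) {t p x y k : ℕ} (ht : T₀ ≤ t)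
    (hx : (erun L aw t x).J p ≠ none) (hxy : within L k x y) :
    (erun L aw (t + k) y).J p ≠ none := by
  induction k generalizing y with
  | zero => cases hxy; exact hx
  | succ k ih =>
    obtain ⟨z, hz, rfl | hy⟩ := hxy
    · obtain ⟨j, hj⟩ := Option.ne_none_iff_exists'.1 (ih hz)
      rw [← add_assoc, (erun_le_succ (L := L) (aw := aw) (t + k) _).J hj]
      exact Option.some_ne_none _
    · rw [← add_assoc]
      exact J_succ_ne_none (hs.aw_mono (by omega) (hs.awAll (hs.net.sub _ hy)))
        (Or.inr ⟨z, hs.net.symm _ _ hy, ih hz⟩)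

/-- Each step down a tree costs a round, so depth is bounded by the time since the phase first
appeared. The bound `K` alone would not do, since trees may grow along detours while some nodes are
asleep. -/
theorem dep_le {s t p x : ℕ} {j : Position} (h0 : ∀ x, (erun L aw s x).J p = none)
    (hj : (erun L aw t x).J p = some j) : s + j.dep + 1 ≤ t := by
  induction t generalizing x j with
  | zero => cases hj
  | succ t ih =>
    obtain h1 | ⟨-, ⟨rfl, h1⟩ | ⟨w, hw, jw, h1, rfl⟩⟩ := J_succ hj
    · exact (ih h1).trans (Nat.le_succ t)
    · by_contra hlt
      have h2 := (erun_le (L := L) (aw := aw) (s := t + 1) (t := s) (by simp at hlt; omega) x).J hj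
      rw [h0] at h2
      cases h2
    · have := ih h1
      simp only
      omega

/-- Convergecast along the trees of a phase. -/
theorem convergecast (hs : ElectionSetup L U aw T₀ K) {τ d p : ℕ} {Q : ℕ → ℕ → Prop}
    (hJ : ∀ x ∈ U, ∃ j, (erun L aw τ x).J p = some j ∧ j.dep ≤ d)
    (hQ : ∀ t ≥ τ, ∀ x ∈ U, (∀ w ∈ L x, ∀ j, (erun L aw τ w).J p = some j → j.parent = x → Q t w) →
      Q (t + 1) x) {x : ℕ} (hx : x ∈ U) : Q (τ + (d + 1)) x := by
  -- A node at depth `e` is ready after `d + 1 - e` rounds; its children lie one level deeper and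
  -- are ready one round earlier.
  have key : ∀ m x, x ∈ U → ∀ j, (erun L aw τ x).J p = some j → d < j.dep + m → Q (τ + m) x := by
    intro m
    induction m with
    | zero =>
      intro x hx j hj hd
      obtain ⟨j', h1, h2⟩ := hJ x hx
      cases hj.symm.trans h1
      omega
    | succ m ih =>
      intro x hx j hj hd
      refine hQ (τ + m) (by omega) x hx fun w hw jw hjw hpar => ?_
      refine ih w (hs.net.sub _ hw) jw hjw ?_
      obtain ⟨rfl, -⟩ | ⟨x', hx', j', h1, rfl⟩ := (electionInv hs τ).J hjw
      · cases hpar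
        exact absurd hw (hs.net.irrefl w)
      · cases hpar
        cases hj.symm.trans h1
        simp only
        omega
  obtain ⟨j, h1, -⟩ := hJ x hx
  exact key (d + 1) x hx j h1 (by omega)

/-- The duration of a phase. -/
theorem phase_step (hs : ElectionSetup L U aw T₀ K) {τ d p : ℕ} (hU : U.Nonempty) (hτ : T₀ ≤ τ)
    (hJ : ∀ x ∈ U, ∃ j, (erun L aw τ x).J p = some j ∧ j.dep ≤ d) :
    (∃ x ∈ U, (erun L aw (τ + (3 * d + 4)) x).Wins x) ∨
      ∃ x ∈ U, (erun L aw (τ + (3 * d + 4)) x).J (p + 1) ≠ none := by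
  have aw' : ∀ t ≥ τ, ∀ x ∈ U, aw t x := fun t ht x hx => hs.aw_mono (hτ.trans ht) (hs.awAll hx)
  have J' : ∀ t ≥ τ, ∀ x ∈ U, ∃ j, (erun L aw t x).J p = some j ∧ (erun L aw τ x).J p = some j ∧
      j.dep ≤ d := fun t ht x hx => by
    obtain ⟨j, h1, h2⟩ := hJ x hx
    exact ⟨j, (erun_le ht x).J h1, h1, h2⟩
  have hE : ∀ x ∈ U, (erun L aw (τ + (d + 1)) x).E p ≠ none := fun x hx =>
    convergecast hs (Q := fun t x => (erun L aw t x).E p ≠ none) hJ (fun t ht x hx h => by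
      obtain ⟨j, h1, -⟩ := J' t ht x hx
      refine E_succ_ne_none (aw' t ht x hx) (h1 ▸ Option.some_ne_none _) fun w hw => ?_
      obtain ⟨jw, h2, h3, -⟩ := J' t ht w (hs.net.sub _ hw)
      exact ⟨jw, h2, h w hw jw h3⟩) hx
  set t₁ := τ + (d + 1) with ht₁
  by_cases hwin : ∃ x ∈ U, (erun L aw t₁ x).Wins x
  · obtain ⟨x, hx, h⟩ := hwin
    exact Or.inl ⟨x, hx, h.mono (erun_le (by omega) x)⟩
  right
  have hF : ∀ m x, x ∈ U → ∀ j, (erun L aw τ x).J p = some j → j.dep < m →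
      (erun L aw (t₁ + m) x).F p ≠ none := by
    intro m
    induction m with
    | zero => intro _ _ _ _ h; omega
    | succ m ih =>
      intro x hx j hj hd
      have hj' := (erun_le (L := L) (aw := aw) (s := τ) (t := t₁ + m) (by omega) x).J hj
      rw [← add_assoc]
      refine F_succ_ne_none (aw' _ (by omega) x hx) hj' ?_
      obtain ⟨rfl, -⟩ | ⟨w, hw, jw, h1, rfl⟩ := (electionInv hs τ).J hj
      · left
        obtain ⟨S, hS⟩ := Option.ne_none_iff_exists'.1 (hE x hx)
        rw [(erun_le (L := L) (aw := aw) (s := t₁) (t := t₁ + m) (by omega) x).E hS]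
        refine ⟨rfl, Option.some_ne_none _, fun h2 => hwin ⟨x, hx, p, ?_, h2 ▸ hS⟩⟩
        exact (erun_le (L := L) (aw := aw) (s := τ) (t := t₁) (by omega) x).J hj
      · exact Or.inr ⟨Nat.succ_ne_zero _, hw, ih w (hs.net.sub _ hw) jw h1 (by simp at hd; omega)⟩
  set t₂ := t₁ + (d + 1) with ht₂
  have hF' : ∀ t ≥ t₂, ∀ x ∈ U, (erun L aw t x).F p ≠ none := by
    intro t ht x hx
    obtain ⟨j, h1, h2⟩ := hJ x hx
    obtain ⟨S, hS⟩ := Option.ne_none_iff_exists'.1 (hF (d + 1) x hx j h1 (by omega))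
    rw [(erun_le ht x).F hS]
    exact Option.some_ne_none _
  have hD : ∀ x ∈ U, (erun L aw (t₂ + (d + 1)) x).D p ≠ none := fun x hx =>
    convergecast hs (Q := fun t x => (erun L aw t x).D p ≠ none) (fun x hx => by
      obtain ⟨j, h1, -, h2⟩ := J' t₂ (by omega) x hx
      exact ⟨j, h1, h2⟩) (fun t ht x hx h => by
      refine D_succ_ne_none (aw' t (by omega) x hx) (hF' t ht x hx) fun w hw => ?_
      have hwU := hs.net.sub _ hw
      obtain ⟨jw, h2, h3, -⟩ := J' t (by omega) w hwU
      refine ⟨hF' t ht w hwU, jw, h2, h w hw jw ?_⟩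
      exact (erun_le (L := L) (aw := aw) (s := τ) (t := t₂) (by omega) w).J h3) hx
  set t₃ := t₂ + (d + 1) with ht₃
  have inv := electionInv hs t₃
  obtain ⟨x₀, hx₀⟩ := hU
  obtain ⟨j₀, hj₀, -⟩ := J' t₃ (by omega) x₀ hx₀
  have hne : (roots U (erun L aw t₃) p).Nonempty := ⟨_, inv.mem_roots.2 (inv.root hj₀)⟩
  -- The largest root of the phase passes the test whatever it has collected. The duration is `d +
  -- 1` rounds for each of `E`, `F`, `D` and one for the new position.
  have hM := inv.mem_roots.1 (Finset.max'_mem _ hne)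
  set M := (roots U (erun L aw t₃) p).max' hne with hMdef
  have hMU : M ∈ U := inv.mem (hM ▸ Option.some_ne_none _)
  obtain ⟨S, hS⟩ := Option.ne_none_iff_exists'.1 (hD M hMU)
  refine ⟨M, hMU, ?_⟩
  rw [show τ + (3 * d + 4) = t₃ + 1 by omega]
  refine J_succ_ne_none (aw' _ (by omega) M hMU) (Or.inl ⟨hM, S, hS, fun x hx => ?_⟩)
  exact Finset.le_max' _ _ (inv.mem_roots.2 ((inv.D hS).2.2 x hx))

theorem exists_wins_or_phase (hs : ElectionSetup L U aw T₀ K) (hU : U.Nonempty) (p : ℕ) :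
    (∃ x ∈ U, (erun L aw (4 * T₀ + 1 + p * (4 * K + 4)) x).Wins x) ∨
      ∃ x ∈ U, (erun L aw (4 * T₀ + 1 + p * (4 * K + 4)) x).J p ≠ none := by
  classical
  induction p with
  | zero =>
    obtain ⟨x, hx⟩ := hU
    rw [zero_mul, add_zero]
    exact Or.inr ⟨x, hx, J_succ_ne_none (hs.aw_mono (by omega) (hs.awAll hx)) (Or.inl trivial)⟩
  | succ p ih =>
    obtain ⟨x, hx, h⟩ | ⟨x, hx, h⟩ := ih
    · exact Or.inl ⟨x, hx, h.mono (erun_le (by gcongr; omega) x)⟩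
    -- The clock starts when the first node enters phase `p`; this may be before all nodes are
    -- awake.
    have hex : ∃ t, ∃ x, (erun L aw t x).J p ≠ none := ⟨_, x, h⟩
    obtain ⟨y, hy⟩ := Nat.find_spec hex
    have hle : Nat.find hex ≤ 4 * T₀ + 1 + p * (4 * K + 4) := Nat.find_min' hex ⟨x, h⟩
    obtain ⟨s, hs'⟩ : ∃ s, Nat.find hex = s + 1 := by
      refine Nat.exists_eq_succ_of_ne_zero fun h0 => ?_
      rw [h0] at hy
      exact hy rfl
    have hmin : ∀ x, (erun L aw s x).J p = none := by
      intro x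
      by_contra hx
      exact Nat.find_min hex (m := s) (by omega) ⟨x, hx⟩
    rw [hs'] at hy hle
    have hyU := (electionInv hs _).mem hy
    set τ := max (s + 1) T₀ + K with hτ
    have hy' : (erun L aw (max (s + 1) T₀) y).J p ≠ none := by
      obtain ⟨j, hj⟩ := Option.ne_none_iff_exists'.1 hy
      rw [(erun_le (le_max_left _ _) y).J hj]
      exact Option.some_ne_none _
    have hJ : ∀ x ∈ U, ∃ j, (erun L aw τ x).J p = some j ∧ j.dep ≤ τ - (s + 1) := by
      intro x hx
      obtain ⟨j, hj⟩ := Option.ne_none_iff_exists'.1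
        (J_ne_none_of_within hs (le_max_right _ _) hy' (hs.conn y hyU x hx))
      exact ⟨j, hj, by have := dep_le hmin hj; omega⟩
    -- If the phase starts after `T₀`, depths are at most `K` and it costs `4 * K + 4`. If it starts
    -- earlier, depths are at most `T₀ + K` and everything ends by `4 * (T₀ + K) + 4`; hence the
    -- initial term `4 * T₀`.
    have hfin : τ + (3 * (τ - (s + 1)) + 4) ≤ 4 * T₀ + 1 + (p + 1) * (4 * K + 4) := by
      have h1 : (p + 1) * (4 * K + 4) = p * (4 * K + 4) + (4 * K + 4) := by ring
      have h2 := le_total (s + 1) T₀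
      rw [h1]
      rcases h2 with h2 | h2
      · rw [max_eq_right h2] at hτ
        omega
      · rw [max_eq_left h2] at hτ
        omega
    obtain ⟨x, hx, h⟩ | ⟨x, hx, h⟩ := phase_step hs hU (by omega) hJ
    · exact Or.inl ⟨x, hx, h.mono (erun_le hfin x)⟩
    · refine Or.inr ⟨x, hx, ?_⟩
      obtain ⟨j, hj⟩ := Option.ne_none_iff_exists'.1 h
      rw [(erun_le hfin x).J hj]
      exact Option.some_ne_none _

/-- The leader is found in time `O(T₀ + K log n)`. -/
theorem exists_wins (hs : ElectionSetup L U aw T₀ K) (hU : U.Nonempty) :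
    ∃ x ∈ U, (erun L aw (4 * T₀ + 1 + (Nat.log 2 U.card + 1) * (4 * K + 4)) x).Wins x := by
  refine (exists_wins_or_phase hs hU (Nat.log 2 U.card + 1)).resolve_right ?_
  rintro ⟨x, -, hx⟩
  exact lt_irrefl _ ((electionInv hs _).phase_lt hs hx)

end time

end election

/-! ### The combined algorithm -/

/-- The state of a node: the state of the spanner construction, its own record and the last known
records of its neighbors, whether its record has just changed, the leader if it is known, and the
output. -/
structure LeaderState where
  sp : SpState
  record : Rec
  copies : ℕ → Rec
  changed : Prop
  leader : Option ℕ
  output : Option ℕ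

structure LeaderMsg where
  rumors : Option (Finset ℕ)
  record : Option Rec
  leader : Option ℕ

namespace LeaderState

open Classical in
-- Records are sent only after a change, which keeps the messages few; receivers rely on their
-- stored copies otherwise.
noncomputable def message (s : LeaderState) (y : ℕ) : LeaderMsg where
  rumors := s.sp.send y
  record := if s.changed ∧ y ∈ s.sp.links then some s.record else none
  leader := if y ∈ s.sp.links then s.leader else none

open Classical in
noncomputable def send (s : LeaderState) (y : ℕ) : Option LeaderMsg :=
  if s.message y = ⟨none, none, none⟩ then none else some (s.message y)

noncomputable def newCopies (s : LeaderState) (inbox : ℕ → Option LeaderMsg) (y : ℕ) : Rec :=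
  ((inbox y).bind LeaderMsg.record).getD (s.copies y)

noncomputable def newRec (s : LeaderState) (inbox : ℕ → Option LeaderMsg) : Rec :=
  if s.sp.unk = ∅ then
    s.record.update s.sp.me s.sp.links (restrictRec s.sp.links (s.newCopies inbox))
  else s.record

open Classical in
noncomputable def newLeader (s : LeaderState) (inbox : ℕ → Option LeaderMsg) : Option ℕ :=
  s.leader.or <| if (s.newRec inbox).Wins s.sp.me then some s.sp.me else
    (pick (s.sp.links.filter fun y => (inbox y).bind LeaderMsg.leader ≠ none)).bind fun y =>
      (inbox y).bind LeaderMsg.leader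

noncomputable def receive (s : LeaderState) (inbox : ℕ → Option LeaderMsg) : LeaderState where
  sp := s.sp.recv fun y => (inbox y).bind LeaderMsg.rumors
  record := s.newRec inbox
  copies := s.newCopies inbox
  changed := s.newRec inbox ≠ s.record
  leader := s.newLeader inbox
  output := s.leader

theorem send_bind_rumors (s : LeaderState) (y : ℕ) :
    (s.send y).bind LeaderMsg.rumors = s.sp.send y := by
  rw [send]
  split_ifs with h
  · exact (congrArg LeaderMsg.rumors h).symm
  · rfl

theorem send_bind_rec (s : LeaderState) (y : ℕ) :
    (s.send y).bind LeaderMsg.record = (s.message y).record := by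
  rw [send]
  split_ifs with h
  · exact (congrArg LeaderMsg.record h).symm
  · rfl

theorem send_bind_leader (s : LeaderState) (y : ℕ) :
    (s.send y).bind LeaderMsg.leader = (s.message y).leader := by
  rw [send]
  split_ifs with h
  · exact (congrArg LeaderMsg.leader h).symm
  · rfl

theorem send_ne_none {s : LeaderState} {y : ℕ} (h : s.send y ≠ none) :
    s.sp.send y ≠ none ∨ (s.changed ∧ y ∈ s.sp.links) ∨ (s.leader ≠ none ∧ y ∈ s.sp.links) := by
  rw [send] at h
  by_contra! hcon
  obtain ⟨h1, h2, h3⟩ := hcon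
  refine h (if_pos ?_)
  rw [message, h1, if_neg (fun h4 => h2 h4.1 h4.2)]
  congr 1
  split_ifs with h5
  · by_contra h6
    exact h3 h6 h5
  · rfl

end LeaderState

/-- The leader election algorithm: construction of a sparse spanner, election of a leader on the
spanner, and announcement of the leader. -/
noncomputable def leaderElection : KT1LocalAlgorithm ℕ where
  State := LeaderState
  Msg := LeaderMsg
  -- An isolated node of a connected network is the whole network and stops at once, as the bounds
  -- vanish for `n = 1`.
  init i N := ⟨SpState.init i N, Rec.empty, fun _ => Rec.empty, False, none,
    if N = ∅ then some i else none⟩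
  send := LeaderState.send
  receive := LeaderState.receive
  output := LeaderState.output

/-! ### The real execution follows the execution without termination -/

section run
variable {N : ℕ → Finset ℕ} {U : Finset ℕ}

variable (N U) in
/-- The node `x` knows all its spanner edges in round `t`. -/
def awake (t x : ℕ) : Prop := x ∈ U ∧ (sp N t x).unk = ∅

variable (N U) in
/-- The records in the absence of termination. -/
noncomputable def recs : ℕ → ℕ → Rec := erun (spanner N) (awake N U)

theorem electionSetup (hN : IsNet N U) {D : ℕ} (hD : ∀ x ∈ U, ∀ y ∈ U, within N D x y) :
    ElectionSetup (spanner N) U (awake N U) (iterStart (Nat.log 2 U.card))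
      (2 * Nat.log 2 U.card * D) where
  net := spanner_isNet hN
  conn x hx y hy := within.stretch (fun _ _ => spanner_stretch hN) (hD x hx y hy)
  awU h := h.1
  awMono h := ⟨h.1, unk_mono_time (Nat.le_succ _) h.2⟩
  awAll h := ⟨h, unk_time_eq_empty hN le_rfl⟩

variable (N U) in
/-- The node `x` knows the leader after round `t`. -/
def informed : ℕ → ℕ → Prop
  | 0, _ => False
  | t + 1, x => informed t x ∨ (recs N U (t + 1) x).Wins x ∨ ∃ y ∈ spanner N x, informed t y

variable (N U) in
/-- The node `x` has terminated after round `t`. -/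
def finished : ℕ → ℕ → Prop
  | 0, _ => False
  | t + 1, x => informed N U t x

variable (N U) in
/-- The record of the node `x` changed in the last round. -/
def recChanged : ℕ → ℕ → Prop
  | 0, _ => False
  | t + 1, x => recs N U (t + 1) x ≠ recs N U t x

variable (N U) in
/-- The node `x` announces the leader in round `t`. -/
def announces (t x : ℕ) : Prop := informed N U t x ∧ ¬ finished N U t x

theorem informed_mono {s t x : ℕ} (hst : s ≤ t) (h : informed N U s x) : informed N U t x := by
  induction hst with
  | refl => exact h
  | step _ ih => exact Or.inl ih

theorem informed_of_finished {t x : ℕ} (h : finished N U t x) : informed N U t x := by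
  cases t with
  | zero => exact h
  | succ t => exact Or.inl h

/-- A node announces the leader before it terminates, so an uninformed node has no terminated
spanner neighbor. -/
theorem informed_of_mem {t x y : ℕ} (hy : y ∈ spanner N x) (h : finished N U t y) :
    informed N U t x := by
  cases t with
  | zero => exact h.elim
  | succ t => exact Or.inr (Or.inr ⟨y, hy, h⟩)

theorem exists_wins_of_informed {t x : ℕ} (h : informed N U t x) : ∃ v, (recs N U t v).Wins v := by
  induction t generalizing x with
  | zero => exact h.elim
  | succ t ih =>
    obtain h | h | ⟨y, -, h⟩ := h
    · obtain ⟨v, hv⟩ := ih h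
      exact ⟨v, hv.mono (erun_le_succ _ _)⟩
    · exact ⟨x, h⟩
    · obtain ⟨v, hv⟩ := ih h
      exact ⟨v, hv.mono (erun_le_succ _ _)⟩

theorem informed_of_within {t x y k : ℕ} (hN : ∀ x y, y ∈ spanner N x → x ∈ spanner N y)
    (hx : informed N U t x) (h : within (spanner N) k x y) : informed N U (t + k) y := by
  induction k generalizing y with
  | zero => cases h; exact hx
  | succ k ih =>
    obtain ⟨z, hz, rfl | hy⟩ := h
    · exact Or.inl (ih hz)
    · exact Or.inr (Or.inr ⟨z, hN _ _ hy, ih hz⟩)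

theorem awake_of_recChanged {t x : ℕ} (h : recChanged N U t x) : (sp N t x).unk = ∅ := by
  cases t with
  | zero => exact h.elim
  | succ t =>
    by_contra h1
    refine h ?_
    rw [recs, erun, if_neg]
    intro h2
    exact h1 (unk_mono_time (Nat.le_succ t) h2.2)

theorem sp_me (t x : ℕ) : (sp N t x).me = x := by
  obtain ⟨i, k, hk, rfl⟩ := exists_iterStart t
  exact (spInv hk x).me

open Classical in
/-- The state of the node `x` in round `t`, where `c` is the leader. -/
structure RunInv (N : ℕ → Finset ℕ) (U : Finset ℕ) (c t x : ℕ) (s : LeaderState) : Prop where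
  fin : finished N U t x → s.output = some c
  output : ¬ finished N U t x → s.output = none
  sp : ¬ finished N U t x → s.sp = _root_.sp N t x
  record : ¬ finished N U t x → s.record = recs N U t x
  leader : ¬ finished N U t x → s.leader = if informed N U t x then some c else none
  changed : ¬ finished N U t x → (s.changed ↔ recChanged N U t x)
  copies : ¬ finished N U t x → ∀ y ∈ spanner N x, ¬ recChanged N U t y → s.copies y = recs N U t y

theorem runInv_zero (hne : ∀ x ∈ U, N x ≠ ∅) (c : ℕ) {x : ℕ} (hx : x ∈ U) :
    RunInv N U c 0 x (leaderElection.netRun N 0 x) where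
  fin h := h.elim
  output _ := if_neg (hne x hx)
  sp _ := rfl
  record _ := rfl
  leader _ := (if_neg id).symm
  changed _ := Iff.rfl
  copies _ _ _ _ := rfl

theorem runInv_succ (hN : IsNet N U) {c t : ℕ}
    (haw : ∀ t v x, (recs N U t v).Wins v → x ∈ U → (sp N t x).unk = ∅)
    (hc : ∀ t v, (recs N U t v).Wins v → v = c) {s : ℕ → LeaderState}
    (ih : ∀ x ∈ U, RunInv N U c t x (s x)) {x : ℕ} (hx : x ∈ U) :
    RunInv N U c (t + 1) x (leaderElection.netStep N s x) := by
  classical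
  have hL := spanner_isNet hN
  have ix := ih x hx
  by_cases hfx : finished N U t x
  · have h1 : leaderElection.netStep N s x = s x := by
      refine if_neg ?_
      change (s x).output ≠ none
      rw [ix.fin hfx]
      exact Option.some_ne_none _
    have h2 : finished N U (t + 1) x := informed_of_finished hfx
    rw [h1]
    exact ⟨fun _ => ix.fin hfx, fun h => absurd h2 h, fun h => absurd h2 h, fun h => absurd h2 h,
      fun h => absurd h2 h, fun h => absurd h2 h, fun h => absurd h2 h⟩
  obtain ⟨inbox, hinbox, hstep⟩ : ∃ inbox : ℕ → Option LeaderMsg,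
      (∀ y, inbox y = if y ∈ N x ∧ (s y).output = none then (s y).send x else none) ∧
      leaderElection.netStep N s x = (s x).receive inbox :=
    ⟨_, fun _ => rfl, if_pos (ix.output hfx)⟩
  rw [hstep]
  refine ⟨fun h => ?_, fun h => ?_, fun h => ?_, fun h => ?_, fun h => ?_, fun h => ?_, fun h => ?_⟩
  · change (s x).leader = _
    rw [ix.leader hfx]
    exact if_pos h
  · change (s x).leader = _
    rw [ix.leader hfx]
    exact if_neg h
  all_goals
    -- Being finished after round `t + 1` means being informed after round `t`, so only uninformed
    -- nodes remain, all of whose spanner neighbors are still running.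
    replace h : ¬ informed N U t x := h
    have hnf : ∀ y ∈ spanner N x, ¬ finished N U t y := fun y hy h' => h (informed_of_mem hy h')
    have hyU : ∀ y ∈ spanner N x, y ∈ U := fun y hy => hL.sub x hy
    have hin : ∀ y ∈ spanner N x, inbox y = (s y).send x := fun y hy => by
      rw [hinbox, if_pos ⟨(mem_spanner.1 hy).1, (ih y (hyU y hy)).output (hnf y hy)⟩]
    have hcop : ∀ y ∈ spanner N x, (s x).newCopies inbox y = recs N U t y := by
      intro y hy
      have iy := ih y (hyU y hy)
      rw [LeaderState.newCopies, hin y hy, LeaderState.send_bind_rec, LeaderState.message]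
      by_cases hch : recChanged N U t y
      · have h1 : x ∈ (s y).sp.links := by
          rw [iy.sp (hnf y hy), links_eq hN.symm (awake_of_recChanged hch)]
          exact hL.symm _ _ hy
        simp only [(iy.changed (hnf y hy)).2 hch, h1, and_self, if_true, Option.getD_some]
        exact iy.record (hnf y hy)
      · have h1 : ¬ (s y).changed := fun h' => hch ((iy.changed (hnf y hy)).1 h')
        simp only [h1, false_and, if_false, Option.getD_none]
        exact ix.copies hfx y hy hch
    have hrec : (s x).newRec inbox = recs N U (t + 1) x := by
      rw [LeaderState.newRec, ix.sp hfx, ix.record hfx, recs, erun, sp_me]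
      by_cases ha : (sp N t x).unk = ∅
      · rw [if_pos ha, if_pos ⟨hx, ha⟩, links_eq hN.symm ha]
        congr 1
        funext y
        rw [restrictRec, restrictRec]
        split_ifs with hy
        · exact hcop y hy
        · rfl
      · rw [if_neg ha, if_neg fun h' => ha h'.2]
  · change (s x).sp.recv _ = (sp N t x).recv _
    rw [ix.sp hfx]
    congr 1
    funext y
    rw [spInbox]
    split_ifs with hy
    · have hyU' := hN.sub x hy
      by_cases hfy : finished N U t y
      · have h1 : y ∉ spanner N x := fun h' => hnf y h' hfy
        have h2 : (sp N t y).send x = none := by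
          by_contra h'
          exact h1 (hL.symm _ _ (mem_spanner_of_send hN.symm h'))
        rw [h2, hinbox, if_neg]
        · rfl
        · rintro ⟨-, h3⟩
          rw [(ih y hyU').fin hfy] at h3
          cases h3
      · rw [hinbox, if_pos ⟨hy, (ih y hyU').output hfy⟩, LeaderState.send_bind_rumors,
          (ih y hyU').sp hfy]
    · rw [hinbox, if_neg fun h' => hy h'.1]
      rfl
  · exact hrec
  · change (s x).newLeader inbox = _
    rw [LeaderState.newLeader, ix.leader hfx, if_neg h, Option.none_or, hrec, ix.sp hfx, sp_me]
    have hlead : ∀ y ∈ spanner N x, (inbox y).bind LeaderMsg.leader =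
        if informed N U t y then some c else none := by
      intro y hy
      have iy := ih y (hyU y hy)
      rw [hin y hy, LeaderState.send_bind_leader, LeaderState.message]
      simp only [iy.leader (hnf y hy), iy.sp (hnf y hy)]
      by_cases hfl : informed N U t y
      -- An informed node presupposes a winner, hence all nodes are awake and `y` knows its edge to
      -- `x`.
      · obtain ⟨v, hv⟩ := exists_wins_of_informed hfl
        rw [links_eq hN.symm (haw t v y hv (hyU y hy)), if_pos (hL.symm _ _ hy)]
      · simp [hfl]
    by_cases hw : (recs N U (t + 1) x).Wins x
    · have h1 : informed N U (t + 1) x := Or.inr (Or.inl hw)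
      rw [if_pos hw, if_pos h1, hc _ _ hw]
    rw [if_neg hw]
    by_cases hfl : ∃ y ∈ spanner N x, informed N U t y
    · obtain ⟨y, hy, hfy⟩ := hfl
      obtain ⟨v, hv⟩ := exists_wins_of_informed hfy
      have h1 : informed N U (t + 1) x := Or.inr (Or.inr ⟨y, hy, hfy⟩)
      rw [if_pos h1, links_eq hN.symm (haw t v x hv hx)]
      obtain ⟨z, hz⟩ := exists_pick
        (s := (spanner N x).filter fun y => (inbox y).bind LeaderMsg.leader ≠ none)
        ⟨y, Finset.mem_filter.2 ⟨hy, by rw [hlead y hy, if_pos hfy]; exact Option.some_ne_none _⟩⟩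
      obtain ⟨h1, h2⟩ := Finset.mem_filter.1 (mem_of_pick hz)
      rw [hz, Option.bind_some]
      rw [hlead z h1] at h2 ⊢
      split_ifs at h2 ⊢ with h3
      · rfl
      · exact absurd rfl h2
    · have h1 : ¬ informed N U (t + 1) x := by
        rintro (h1 | h1 | h1)
        exacts [h h1, hw h1, hfl h1]
      rw [if_neg h1, Finset.filter_false_of_mem, pick_empty, Option.bind_none]
      intro y hy
      have hy' := links_subset t x hy
      rw [hlead y hy', if_neg fun h' => hfl ⟨y, hy', h'⟩, not_not]
  · change ((s x).newRec inbox ≠ (s x).record) ↔ _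
    rw [hrec, ix.record hfx]
    rfl
  · intro y hy hch
    change (s x).newCopies inbox y = _
    rw [hcop y hy]
    by_contra h1
    exact hch (Ne.symm h1)

theorem runInv (hN : IsNet N U) (hne : ∀ x ∈ U, N x ≠ ∅) {c : ℕ}
    (haw : ∀ t v x, (recs N U t v).Wins v → x ∈ U → (sp N t x).unk = ∅)
    (hc : ∀ t v, (recs N U t v).Wins v → v = c) (t : ℕ) :
    ∀ x ∈ U, RunInv N U c t x (leaderElection.netRun N t x) := by
  induction t with
  | zero => exact fun x hx => runInv_zero hne c hx
  | succ t ih => exact fun x hx => runInv_succ hN haw hc ih hx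

/-! ### Total number of messages -/

open Classical in
/-- If every node `x` has a property in at most `m` rounds, then the messages that are sent along
the edges of `L` in these rounds are at most `m` times the number of these edges. -/
theorem sum_card_pairs_le (L : ℕ → Finset ℕ) (Q : ℕ → ℕ → Prop) {m t : ℕ}
    (h : ∀ x ∈ U, ((Finset.range t).filter fun r => Q r x).card ≤ m) :
    ∑ r ∈ Finset.range t, ((U ×ˢ U).filter fun p : ℕ × ℕ => Q r p.1 ∧ p.2 ∈ L p.1).card ≤
      m * ∑ x ∈ U, (L x).card := by
  have h1 : ∀ r, ((U ×ˢ U).filter fun p : ℕ × ℕ => Q r p.1 ∧ p.2 ∈ L p.1).card ≤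
      ∑ x ∈ U, if Q r x then (L x).card else 0 := by
    intro r
    rw [← Finset.sum_filter, ← Finset.card_sigma]
    refine Finset.card_le_card_of_injOn (fun p => ⟨p.1, p.2⟩) ?_ ?_
    · rintro ⟨x, y⟩ hp
      obtain ⟨h1, h2, h3⟩ := Finset.mem_filter.1 hp
      simp only [Finset.coe_sigma, Set.mem_sigma_iff, Finset.mem_coe, Finset.mem_filter]
      exact ⟨⟨(Finset.mem_product.1 h1).1, h2⟩, h3⟩
    · rintro ⟨x, y⟩ - ⟨x', y'⟩ - h
      cases h
      rfl
  refine (Finset.sum_le_sum fun r _ => h1 r).trans ?_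
  rw [Finset.sum_comm, Finset.mul_sum]
  refine Finset.sum_le_sum fun x hx => ?_
  rw [← Finset.sum_filter, Finset.sum_const, smul_eq_mul]
  exact Nat.mul_le_mul_right _ (h x hx)

open Classical in
theorem card_recChanged_le {T₀ K : ℕ} (hs : ElectionSetup (spanner N) U (awake N U) T₀ K)
    (x t : ℕ) : ((Finset.range t).filter fun r => recChanged N U r x).card ≤
      4 * (Nat.log 2 U.card + 1) := by
  refine le_trans ?_ (card_changes_le hs x t)
  apply Finset.card_le_card_of_injOn (fun r => r - 1)
  · intro r hr
    obtain ⟨h1, h2⟩ := Finset.mem_filter.1 hr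
    cases r with
    | zero => exact h2.elim
    | succ r =>
      refine Finset.mem_coe.2 (Finset.mem_filter.2 ⟨?_, h2⟩)
      rw [Finset.mem_range] at h1 ⊢
      exact (Nat.le_succ _).trans_lt h1
  · intro r hr r' hr' h
    have h1 := (Finset.mem_filter.1 hr).2
    have h2 := (Finset.mem_filter.1 hr').2
    cases r with
    | zero => exact h1.elim
    | succ r =>
      cases r' with
      | zero => exact h2.elim
      | succ r' => simp at h; rw [h]

open Classical in
theorem card_announces_le (x t : ℕ) :
    ((Finset.range t).filter fun r => announces N U r x).card ≤ 1 := by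
  rw [Finset.card_le_one]
  have key : ∀ {r s}, informed N U r x → ¬ finished N U s x → s ≤ r := by
    intro r s h1 h2
    by_contra! hlt
    obtain ⟨s, rfl⟩ := Nat.exists_eq_succ_of_ne_zero (Nat.ne_zero_of_lt hlt)
    exact h2 (informed_mono (by omega) h1)
  intro r hr s hs
  obtain ⟨-, h1, h2⟩ := Finset.mem_filter.1 hr
  obtain ⟨-, h3, h4⟩ := Finset.mem_filter.1 hs
  exact le_antisymm (key h3 h2) (key h1 h4)

open Classical in
theorem sum_card_send_le (hN : IsNet N U) {T₀ K : ℕ}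
    (hs : ElectionSetup (spanner N) U (awake N U) T₀ K) {c : ℕ}
    (hinv : ∀ t, ∀ x ∈ U, RunInv N U c t x (leaderElection.netRun N t x)) (t : ℕ) :
    ∑ r ∈ Finset.range t, ((U ×ˢ U).filter fun p : ℕ × ℕ =>
      leaderElection.output (leaderElection.netRun N r p.1) = none ∧
        leaderElection.send (leaderElection.netRun N r p.1) p.2 ≠ none).card ≤
      U.card * iterStart (Nat.log 2 U.card) +
        (4 * (Nat.log 2 U.card + 1) + 1) * (2 * (U.card * Nat.log 2 U.card)) := by
  -- A message carries rumors, a changed record or the leader. The first kind is counted per round,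
  -- the other two per spanner edge: at most `4 * (log₂ n + 1)` changes and one announcement for
  -- each node.
  have h1 : ∀ r, ((U ×ˢ U).filter fun p : ℕ × ℕ =>
      leaderElection.output (leaderElection.netRun N r p.1) = none ∧
        leaderElection.send (leaderElection.netRun N r p.1) p.2 ≠ none).card ≤
      ((U ×ˢ U).filter fun p : ℕ × ℕ => (sp N r p.1).send p.2 ≠ none).card +
      (((U ×ˢ U).filter fun p : ℕ × ℕ => recChanged N U r p.1 ∧ p.2 ∈ spanner N p.1).card +
      ((U ×ˢ U).filter fun p : ℕ × ℕ => announces N U r p.1 ∧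
        p.2 ∈ spanner N p.1).card) := by
    intro r
    refine le_trans (Finset.card_le_card ?_)
      ((Finset.card_union_le _ _).trans (Nat.add_le_add_left (Finset.card_union_le _ _) _))
    rintro ⟨x, y⟩ hp
    obtain ⟨hp, hout, hsend⟩ := Finset.mem_filter.1 hp
    have ix := hinv r x (Finset.mem_product.1 hp).1
    have hnf : ¬ finished N U r x := fun h => by
      have h' := (ix.fin h).symm.trans hout
      cases h'
    simp only [Finset.mem_union, Finset.mem_filter, hp, true_and]
    have h2 := LeaderState.send_ne_none hsend
    rw [ix.sp hnf, ix.changed hnf, ix.leader hnf] at h2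
    rcases h2 with h2 | ⟨h2, h3⟩ | ⟨h2, h3⟩
    · exact Or.inl h2
    · exact Or.inr (Or.inl ⟨h2, links_subset r x h3⟩)
    · refine Or.inr (Or.inr ⟨⟨?_, hnf⟩, links_subset r x h3⟩)
      by_contra h4
      exact h2 (if_neg h4)
  have h2 := sum_card_pairs_le (U := U) (t := t) (spanner N) (recChanged N U)
    fun x _ => card_recChanged_le hs x t
  have h3 := sum_card_pairs_le (U := U) (t := t) (spanner N)
    (announces N U) fun x _ => card_announces_le x t
  refine (Finset.sum_le_sum fun r _ => h1 r).trans ?_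
  rw [Finset.sum_add_distrib, Finset.sum_add_distrib]
  refine add_le_add (sum_card_sp_send_le hN t) ((add_le_add h2 h3).trans ?_)
  rw [← add_mul]
  exact Nat.mul_le_mul_left _ (sum_card_spanner_le hN)

/-- The leader election on a network with `n` nodes and diameter at most `D`. -/
theorem leaderElection_net (hN : IsNet N U) (hU : U.Nonempty) (hne : ∀ x ∈ U, N x ≠ ∅) {D : ℕ}
    (hD : ∀ x ∈ U, ∀ y ∈ U, within N D x y) : ∃ c ∈ U,
      (∀ t, ∀ x ∈ U, RunInv N U c t x (leaderElection.netRun N t x)) ∧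
      ∀ x ∈ U, finished N U (4 * iterStart (Nat.log 2 U.card) + 1 +
        (Nat.log 2 U.card + 1) * (4 * (2 * Nat.log 2 U.card * D) + 4) +
        2 * Nat.log 2 U.card * D + 1) x := by
  have hs := electionSetup hN hD
  obtain ⟨c, hcU, hc⟩ := exists_wins hs hU
  refine ⟨c, hcU, runInv hN hne (fun t v x h hx => (aw_of_wins hs h hx).2)
    (fun t v h => wins_unique hs h hc), fun x hx => ?_⟩
  refine informed_of_within hs.net.symm ?_ (hs.conn c hcU x hx)
  rw [show ∀ a b : ℕ, a + 1 + b = (a + b) + 1 by intros; omega] at hc ⊢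
  exact Or.inr (Or.inl hc)

end run

/-! ### Numerical bounds and conclusion -/

theorem log_sq_le (n : ℕ) : ((Nat.log 2 n : ℕ) : ℝ) ^ 2 ≤ 4 * Real.log n ^ 2 := by
  rcases Nat.eq_zero_or_pos n with rfl | hn
  · simp
  have h1 : ((2 : ℝ) ^ Nat.log 2 n) ≤ n := by exact_mod_cast Nat.pow_log_le_self 2 hn.ne'
  have h2 := Real.log_le_log (by positivity) h1
  rw [Real.log_pow] at h2
  -- Only `log 2 > 1/2` matters; it gives the factor 2, squared to 4.
  have h3 := Real.log_two_gt_d9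
  have h4 : (0 : ℝ) ≤ (Nat.log 2 n : ℕ) := Nat.cast_nonneg _
  have h5 : ((Nat.log 2 n : ℕ) : ℝ) ≤ 2 * Real.log n := by nlinarith
  calc _ ≤ (2 * Real.log n) ^ 2 := pow_le_pow_left₀ h4 h5 2
    _ = _ := by ring

/-- Since `I ≥ 1`, lower powers of `I` are at most `I ^ 2`; the coefficients with and without `D`
each add up to 18. -/
theorem time_bound {I : ℕ} (hI : 1 ≤ I) (D : ℕ) :
    4 * iterStart I + 1 + (I + 1) * (4 * (2 * I * D) + 4) + 2 * I * D + 1 ≤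
      18 * (D * I ^ 2 + I ^ 2) := by
  obtain ⟨k, rfl⟩ := Nat.exists_eq_add_of_le hI
  unfold iterStart
  nlinarith [Nat.zero_le (D * k), Nat.zero_le (D * k ^ 2), Nat.zero_le (k ^ 2)]

theorem message_bound {I : ℕ} (hI : 1 ≤ I) (n : ℕ) :
    n * iterStart I + (4 * (I + 1) + 1) * (2 * (n * I)) ≤ 20 * (n * I ^ 2) := by
  obtain ⟨k, rfl⟩ := Nat.exists_eq_add_of_le hI
  unfold iterStart
  nlinarith [Nat.zero_le (n * k), Nat.zero_le (n * k ^ 2)]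

open KT1LocalAlgorithm in
theorem leaderElection_of_subsingleton {V : Type*} [Fintype V] [Subsingleton V] (G : SimpleGraph V)
    (ids : V ↪ ℕ) (v : V) :
    ElectsLeaderBy leaderElection G ids 0 ∧ ∀ t, leaderElection.messageCount G ids t = 0 := by
  classical
  have hadj : ∀ v w, ¬ G.Adj v w := fun v w h => h.ne (Subsingleton.elim v w)
  refine ⟨⟨v, fun w => ?_⟩, fun t => Finset.sum_eq_zero fun r _ => ?_⟩
  · rw [run_eq_netRun, Subsingleton.elim w v]
    refine if_pos ?_
    rw [Finset.eq_empty_iff_forall_notMem]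
    intro y hy
    obtain ⟨a, b, -, -, hab⟩ := exists_of_mem_nbrIds G ids hy
    exact hadj a b hab
  · rw [messagesInRound, Finset.card_eq_zero, Finset.filter_eq_empty_iff]
    intro p _
    rw [sent, if_neg fun h => hadj _ _ h.1, not_not]

open KT1LocalAlgorithm in
theorem leaderElection_of_nontrivial {V : Type*} [Fintype V] [Nontrivial V] (G : SimpleGraph V)
    (ids : V ↪ ℕ) (hG : G.Connected) :
    (∃ T, ElectsLeaderBy leaderElection G ids T ∧
      T ≤ 18 * (G.diam * Nat.log 2 (Fintype.card V) ^ 2 + Nat.log 2 (Fintype.card V) ^ 2)) ∧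
    ∀ t, leaderElection.messageCount G ids t ≤
      20 * (Fintype.card V * Nat.log 2 (Fintype.card V) ^ 2) := by
  classical
  set N := nbrIds G ids with hNdef
  set U : Finset ℕ := Finset.univ.map ids with hUdef
  have hcard : U.card = Fintype.card V := by rw [hUdef, Finset.card_map, Finset.card_univ]
  have hmem : ∀ v, ids v ∈ U := fun v => Finset.mem_map_of_mem _ (Finset.mem_univ v)
  have hex : ∀ x ∈ U, ∃ v, ids v = x := fun x hx => by
    obtain ⟨v, -, hv⟩ := Finset.mem_map.1 hx
    exact ⟨v, hv⟩
  have hN : IsNet N U := by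
    refine ⟨fun x y h => ?_, fun x y h => ?_, fun x h => ?_⟩
    · obtain ⟨v, w, -, rfl, -⟩ := exists_of_mem_nbrIds G ids h
      exact hmem w
    · obtain ⟨v, w, rfl, rfl, hvw⟩ := exists_of_mem_nbrIds G ids h
      exact (mem_nbrIds G ids).2 hvw.symm
    · obtain ⟨v, w, rfl, hw, hvw⟩ := exists_of_mem_nbrIds G ids h
      exact hvw.ne (ids.injective hw).symm
  have hne : ∀ x ∈ U, N x ≠ ∅ := by
    intro x hx
    obtain ⟨v, rfl⟩ := hex x hx
    obtain ⟨w, hw⟩ := hG.preconnected.exists_adj_of_nontrivial v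
    exact Finset.ne_empty_of_mem ((mem_nbrIds G ids).2 hw)
  have hD : ∀ x ∈ U, ∀ y ∈ U, within N G.diam x y := by
    intro x hx y hy
    obtain ⟨v, rfl⟩ := hex x hx
    obtain ⟨w, rfl⟩ := hex y hy
    exact within_of_connected G ids hG v w
  have hU : U.Nonempty := ⟨_, hmem (Classical.arbitrary V)⟩
  have hI : 1 ≤ Nat.log 2 (Fintype.card V) :=
    Nat.log_pos (by norm_num) (Fintype.one_lt_card_iff_nontrivial.2 inferInstance)
  obtain ⟨c, hcU, hinv, hfin⟩ := leaderElection_net hN hU hne hD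
  obtain ⟨l, rfl⟩ := hex c hcU
  rw [hcard] at hfin
  refine ⟨⟨_, ⟨l, fun v => ?_⟩, time_bound hI G.diam⟩, fun t => ?_⟩
  · rw [run_eq_netRun]
    exact (hinv _ _ (hmem v)).fin (hfin _ (hmem v))
  · refine le_trans ?_ (message_bound hI (Fintype.card V))
    rw [← hcard]
    exact (Finset.sum_le_sum fun r _ => messagesInRound_le leaderElection G ids r).trans
      (sum_card_send_le hN (electionSetup hN hD) hinv t)

theorem mainTheorem6 :
    ∃ (A : KT1LocalAlgorithm ℕ) (C : ℝ),
      ∀ (V : Type*) [Fintype V] (G : SimpleGraph V) (ids : V ↪ ℕ), G.Connected →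
        (∃ T : ℕ, ElectsLeaderBy A G ids T ∧
          (T : ℝ) ≤ C * ((G.diam : ℝ) * Real.log (Fintype.card V) ^ 2
            + Real.log (Fintype.card V) ^ 2)) ∧
        (∀ t : ℕ, (A.messageCount G ids t : ℝ) ≤
          C * ((Fintype.card V : ℝ) * Real.log (Fintype.card V) ^ 2)) := by
  -- The constant is `20 * 4`: 20 from `message_bound`, which exceeds the 18 of `time_bound`, and 4
  -- from the change to natural logarithms.
  refine ⟨leaderElection, 80, fun V _ G ids hG => ?_⟩
  have hlog := log_sq_le (Fintype.card V)
  have hD : (0 : ℝ) ≤ G.diam := Nat.cast_nonneg _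
  have hn : (0 : ℝ) ≤ Fintype.card V := Nat.cast_nonneg _
  rcases subsingleton_or_nontrivial V with hV | hV
  · obtain ⟨v⟩ := hG.nonempty
    obtain ⟨h1, h2⟩ := leaderElection_of_subsingleton G ids v
    refine ⟨⟨0, h1, ?_⟩, fun t => ?_⟩
    · rw [Nat.cast_zero]; positivity
    · rw [h2, Nat.cast_zero]; positivity
  · obtain ⟨⟨T, h1, h2⟩, h3⟩ := leaderElection_of_nontrivial G ids hG
    refine ⟨⟨T, h1, ?_⟩, fun t => ?_⟩
    · have h2' : (T : ℝ) ≤ 18 * (G.diam * (Nat.log 2 (Fintype.card V) : ℝ) ^ 2 +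
          (Nat.log 2 (Fintype.card V) : ℝ) ^ 2) := by exact_mod_cast h2
      have := mul_le_mul_of_nonneg_left hlog hD
      nlinarith [mul_nonneg hD (sq_nonneg (Real.log (Fintype.card V))),
        sq_nonneg (Real.log (Fintype.card V))]
    · have h3' : (leaderElection.messageCount G ids t : ℝ) ≤
          20 * (Fintype.card V * (Nat.log 2 (Fintype.card V) : ℝ) ^ 2) := by exact_mod_cast h3 t
      have := mul_le_mul_of_nonneg_left hlog hn
      nlinarith
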